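/- **Setting.** All matrices are real. For symmetric $Q,H$ write $H\approx_\epsilon Q$ if $(1-\epsilon)Q\preceq H\preceq(1+\epsilon)Q$ in the Loewner order. For a matrix $B$ with $d$ columns and $a\in\mathbb R^d$, the generalized leverage score of $a$ with respect to $B$ is $a^\top(B^\top B)^\dagger a$ if $a\perp\ker B$, and $\infty$ otherwise; $\sigma^B_i(A)$ denotes this score for the $i$-th row $a_i$ of $A$. For $A$ with $d$ columns, weights $w_i\in[0,\infty]$ and $\epsilon>0$, write $B\overset{w,\epsilon}{\leftarrow}A$ if $B$ is obtained by keeping, independently for each row index $i$, the rescaled row $a_i^\top/\sqrt{p_i}$ with probability $p_i=\min\{1,\,c\,w_i\log(d)/\epsilon^2\}$, where $c>0$ is a fixed oversampling constant. Write $B\subseteq_{1/2}A$ if $B$ is obtained by keeping each row of $A$ independently with probability $1/2$. **Repeated halving** on $A\in\mathbb R^{n\times d}$ with accuracy $\epsilon$: let $L=\lceil\log_2(n/d)\rceil$, sample a chain $A_L\subseteq_{1/2}\dots\subseteq_{1/2}A_1\subseteq_{1/2}A$ and put $B_L=A_L$. For $\ell=L-1,\dots,1$ sample $B_\ell\overset{w,1/2}{\leftarrow}A_\ell$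 with arbitrary weights $2\sigma_i^{B_{\ell+1}}(A_\ell)\le w_i\le4\sigma_i^{B_{\ell+1}}(A_\ell)$. Finally sample the output $\widetilde B\overset{w,\epsilon}{\leftarrow}A$ with arbitrary weights $2\sigma_i^{B_1}(A)\le w_i\le4\sigma_i^{B_1}(A)$. The weights may be chosen adaptively, as any function of the chain and of the samples produced so far. **Lemma (repeated halving, 2-D version).** For every $\kappa>0$ there is $c_0>0$ such that for every oversampling constant $c\ge c_0$ there is $C>0$ with the following property. Let $2\le d<n$, $0<\epsilon\le1$, $A^1,A^2\in\mathbb R^{n\times d}$ and $A=A^1\otimes A^2\in\mathbb R^{n^2\times d^2}$. Run repeated halving independently on $A^1$ and on $A^2$, with intermediate matrices $B^1_\ell,B^2_\ell$ ($1\le\ell\le L$) and outputs $\widetilde B^1,\widetilde B^2$, and let $\widetilde B=\widetilde B^1\otimes\widetilde B^2$. Then, whatever the admissible choice of the weights, with probability at least $1-L\,d^{-\kappa}$ all of the following hold simultaneously: 1. $B^1_\ell$ and $B^2_\ell$ have at most $C\,d\log d$ rows for every $1\le\ell\le L$; 2. $\widetilde B^\top\widetilde B\approx_\epsilon A^\top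 A$ and $A^\top A\approx_\epsilon\widetilde B^\top\widetilde B$; 3. each of $\widetilde B^1,\widetilde B^2$ has at most $C\,d\log(d)/\epsilon^2$ rows, and $\widetilde B$ has at most $C\,d^2\log^2(d)/\epsilon^4$ rows. Moreover, in the polynomial regime the failure probability is inverse polynomial in $n$: for every $\kappa>0$ and $K\in\mathbb N$ there is $c_0>0$ such that for every $c\ge c_0$ there is $C>0$ for which, whenever in addition $n\le d^K$, 1.–3. hold simultaneously with probability at least $1-n^{-\kappa}$. -/

import Mathlib

open scoped ENNReal Matrix Kronecker

noncomputable section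

namespace Halving

/-! ### Linear algebra: pseudo-inverse, generalized leverage scores, spectral approximation -/

/-- The four Penrose equations over `ℝ`: `X` is the Moore–Penrose pseudo-inverse of `G`. -/
structure IsMoorePenrose {d : ℕ} (G X : Matrix (Fin d) (Fin d) ℝ) : Prop where
  mul_mul_self : G * X * G = G
  self_mul_mul : X * G * X = X
  mul_symm : (G * X)ᵀ = G * X
  symm_mul : (X * G)ᵀ = X * G

/-- The pseudo-inverse of a real symmetric matrix `G = U diag(λ) Uᵀ`, namely
`U diag(λ†) Uᵀ` with `λ† = 1 / λ` for `λ ≠ 0` and `0† = 0`. -/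
def pinv {d : ℕ} (G : Matrix (Fin d) (Fin d) ℝ) (hG : G.IsHermitian) :
    Matrix (Fin d) (Fin d) ℝ :=
  (hG.eigenvectorUnitary : Matrix (Fin d) (Fin d) ℝ) *
    Matrix.diagonal (fun k => (hG.eigenvalues k)⁻¹) *
    (hG.eigenvectorUnitary : Matrix (Fin d) (Fin d) ℝ)ᵀ

theorem pinv_isMoorePenrose {d : ℕ} (G : Matrix (Fin d) (Fin d) ℝ) (hG : G.IsHermitian) :
    IsMoorePenrose G (pinv G hG) := by
  have hU : (hG.eigenvectorUnitary : Matrix (Fin d) (Fin d) ℝ)ᵀ *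
      (hG.eigenvectorUnitary : Matrix (Fin d) (Fin d) ℝ) = 1 := by
    have h := Unitary.coe_star_mul_self hG.eigenvectorUnitary
    rwa [Matrix.star_eq_conjTranspose, Matrix.conjTranspose_eq_transpose_of_trivial] at h
  have hspec : G = (hG.eigenvectorUnitary : Matrix (Fin d) (Fin d) ℝ) *
      Matrix.diagonal hG.eigenvalues *
      (hG.eigenvectorUnitary : Matrix (Fin d) (Fin d) ℝ)ᵀ := by
    have h := hG.spectral_theorem
    rw [Unitary.conjStarAlgAut_apply] at h
    rw [Matrix.star_eq_conjTranspose, Matrix.conjTranspose_eq_transpose_of_trivial] at h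
    exact h
  have hX : pinv G hG = (hG.eigenvectorUnitary : Matrix (Fin d) (Fin d) ℝ) *
    Matrix.diagonal (fun k => (hG.eigenvalues k)⁻¹) *
    (hG.eigenvectorUnitary : Matrix (Fin d) (Fin d) ℝ)ᵀ := rfl
  generalize pinv G hG = X at hX
  generalize (hG.eigenvectorUnitary : Matrix (Fin d) (Fin d) ℝ) = U at hU hspec hX
  generalize hG.eigenvalues = e at hspec hX
  have key : ∀ f g : Fin d → ℝ, (U * Matrix.diagonal f * Uᵀ) * (U * Matrix.diagonal g * Uᵀ) =
      U * Matrix.diagonal (fun k => f k * g k) * Uᵀ := by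
    intro f g
    calc _ = U * Matrix.diagonal f * (Uᵀ * U) * Matrix.diagonal g * Uᵀ := by
          simp only [Matrix.mul_assoc]
      _ = _ := by rw [hU, Matrix.mul_one, Matrix.mul_assoc U, Matrix.diagonal_mul_diagonal]
  have symm : ∀ f : Fin d → ℝ, (U * Matrix.diagonal f * Uᵀ)ᵀ = U * Matrix.diagonal f * Uᵀ := by
    intro f
    simp [Matrix.transpose_mul, Matrix.mul_assoc]
  subst hspec hX
  refine ⟨?_, ?_, ?_, ?_⟩
  · rw [key, key]
    congr 3
    funext k
    by_cases h : e k = 0 <;> simp [h]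
  · rw [key, key]
    congr 3
    funext k
    by_cases h : e k = 0 <;> simp [h]
  · rw [key, symm]
  · rw [key, symm]

theorem gram_isHermitian {m : Type*} [Fintype m] {d : ℕ} (B : Matrix m (Fin d) ℝ) :
    (Bᵀ * B).IsHermitian := by
  have h := Matrix.isHermitian_conjTranspose_mul_self B
  rwa [Matrix.conjTranspose_eq_transpose_of_trivial] at h

open Classical in
/-- The generalized leverage score `aᵀ (Bᵀ B)† a` of a row vector `a` with respect to `B`;
it is `∞` when `a` is not orthogonal to `ker B`. -/
def genLeverage {m : Type*} [Fintype m] {d : ℕ} (B : Matrix m (Fin d) ℝ) (a : Fin d → ℝ) :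
    ℝ≥0∞ :=
  if ∀ x : Fin d → ℝ, B *ᵥ x = 0 → a ⬝ᵥ x = 0 then
    ENNReal.ofReal (a ⬝ᵥ (pinv (Bᵀ * B) (gram_isHermitian B) *ᵥ a))
  else ⊤

/-- `(1 - ε) Q ⪯ H ⪯ (1 + ε) Q` in the Loewner order. -/
def SpectralApprox {m : Type*} [Fintype m] (ε : ℝ) (Q H : Matrix m m ℝ) : Prop :=
  (H - (1 - ε) • Q).PosSemidef ∧ ((1 + ε) • Q - H).PosSemidef

/-! ### Random row sampling -/

/-- The random subset of `S` that contains each `i ∈ S` independently with probability `p i`. -/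
def bernoulliSubset {n : ℕ} (S : Finset (Fin n)) (p : Fin n → ℝ≥0∞) (hp : ∀ i, p i ≤ 1) :
    PMF (Finset (Fin n)) :=
  PMF.ofFinset
    (fun T => if T ⊆ S then (∏ i ∈ T, p i) * ∏ i ∈ S \ T, (1 - p i) else 0)
    S.powerset
    (by
      have h : ∑ T ∈ S.powerset,
          (if T ⊆ S then (∏ i ∈ T, p i) * ∏ i ∈ S \ T, (1 - p i) else 0) =
          ∑ T ∈ S.powerset, (∏ i ∈ T, p i) * ∏ i ∈ S \ T, (1 - p i) :=
        Finset.sum_congr rfl fun T hT => if_pos (Finset.mem_powerset.mp hT)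
      rw [h, ← Finset.prod_add]
      exact Finset.prod_eq_one fun i _ => add_tsub_cancel_of_le (hp i))
    (by
      intro T hT
      exact if_neg fun h => hT (Finset.mem_powerset.mpr h))

/-- A choice of rows of an `n`-row matrix, each with a scaling factor. -/
structure RowSample (n : ℕ) where
  rows : Finset (Fin n)
  scale : Fin n → ℝ

/-- The matrix whose rows are the rescaled selected rows of `A`; its number of rows is
`X.rows.card`. -/
def RowSample.toMatrix {n d : ℕ} (X : RowSample n) (A : Matrix (Fin n) (Fin d) ℝ) :
    Matrix X.rows (Fin d) ℝ :=
  fun i j => X.scale i * A i j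

/-- The sampling probability `min {1, c w log d / ε²}` for a weight `w ∈ [0, ∞]`. -/
def sampleProb (c ε : ℝ) (d : ℕ) (w : ℝ≥0∞) : ℝ≥0∞ :=
  min 1 (ENNReal.ofReal (c * Real.log d / ε ^ 2) * w)

/-- Weighted subsampling of the rows in `S`: independently for each `i ∈ S`, the row
`aᵢ / √pᵢ` is kept with probability `pᵢ = min {1, c wᵢ log d / ε²}`. -/
def weightedSample {n : ℕ} (c ε : ℝ) (d : ℕ) (S : Finset (Fin n)) (w : Fin n → ℝ≥0∞) :
    PMF (RowSample n) :=
  (bernoulliSubset S (fun i => sampleProb c ε d (w i)) (fun _ => min_le_left _ _)).map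
    fun T => ⟨T, fun i => 1 / Real.sqrt (sampleProb c ε d (w i)).toReal⟩

/-! ### The repeated halving procedure -/

/-- The random chain `S L ⊆ ⋯ ⊆ S 1 ⊆ S 0` of row sets, where `S 0` consists of all rows and
`S (ℓ + 1)` keeps every element of `S ℓ` independently with probability `1/2`. The matrix `A_ℓ`
consists of the rows of `A` in `S ℓ`. (Entries beyond `L` are never used.) -/
def halvingChain (n : ℕ) : ℕ → PMF (ℕ → Finset (Fin n))
  | 0 => PMF.pure fun _ => Finset.univ
  | L + 1 => (halvingChain n L).bind fun S =>
      (bernoulliSubset (S L) (fun _ => 2⁻¹) (fun _ => by simp)).map fun T =>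
        Function.update S (L + 1) T

/-- A rule for choosing the weights of level `ℓ`. It may look at the whole chain `S` and at the
samples `B` produced so far (those of the levels above `ℓ`). -/
abbrev WeightRule (n : ℕ) : Type :=
  (S : ℕ → Finset (Fin n)) → (B : ℕ → RowSample n) → (ℓ : ℕ) → Fin n → ℝ≥0∞

/-- The rule always chooses `2 σᵢ ≤ wᵢ ≤ 4 σᵢ`, with `σᵢ` the generalized leverage score of the
row `aᵢ` of `A_ℓ` with respect to `B_{ℓ+1}`. -/
def WeightRule.IsValid {n d : ℕ} (rule : WeightRule n) (A : Matrix (Fin n) (Fin d) ℝ) : Prop :=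
  ∀ (S : ℕ → Finset (Fin n)) (B : ℕ → RowSample n) (ℓ : ℕ), ∀ i ∈ S ℓ,
    2 * genLeverage ((B (ℓ + 1)).toMatrix A) (A i) ≤ rule S B ℓ i ∧
      rule S B ℓ i ≤ 4 * genLeverage ((B (ℓ + 1)).toMatrix A) (A i)

/-- Starting from `B_L = A_L`, the first `k` rounds, which produce `B_{L-1}, …, B_{L-k}`. Level
`ℓ ≥ 1` is sampled with accuracy `1/2`, and level `0` (all of `A`) with accuracy `ε`. -/
def halvingRounds {n : ℕ} (d : ℕ) (c ε : ℝ) (rule : WeightRule n) (S : ℕ → Finset (Fin n))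
    (L : ℕ) : ℕ → PMF (ℕ → RowSample n)
  | 0 => PMF.pure fun _ => ⟨S L, fun _ => 1⟩
  | k + 1 => (halvingRounds d c ε rule S L k).bind fun B =>
      (weightedSample c (if L - (k + 1) = 0 then ε else 1 / 2) d (S (L - (k + 1)))
        (rule S B (L - (k + 1)))).map fun X => Function.update B (L - (k + 1)) X

/-- The number of halvings `L = ⌈log₂ (n / d)⌉`. -/
def numLevels (n d : ℕ) : ℕ := ⌈Real.logb 2 ((n : ℝ) / (d : ℝ))⌉₊

/-- The repeated halving algorithm on an `n × d` matrix. It returns all samples: `B ℓ` for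
`1 ≤ ℓ ≤ L` is the intermediate matrix `B_ℓ`, and `B 0` is the output. The input matrix enters
through the leverage scores that constrain the weight rule. -/
def repeatedHalving (n d : ℕ) (c ε : ℝ) (rule : WeightRule n) : PMF (ℕ → RowSample n) :=
  (halvingChain n (numLevels n d)).bind fun S =>
    halvingRounds d c ε rule S (numLevels n d) (numLevels n d)

/-- Independent runs on the two factors. -/
def repeatedHalving₂ (n d : ℕ) (c ε : ℝ) (rule₁ rule₂ : WeightRule n) :
    PMF ((ℕ → RowSample n) × (ℕ → RowSample n)) :=
  (repeatedHalving n d c ε rule₁).bind fun B₁ =>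
    (repeatedHalving n d c ε rule₂).map fun B₂ => (B₁, B₂)

/-- The event that the pair of runs succeeds: every intermediate `B_ℓ` of either run has at most
`C d log d` rows; the output `B̃ = B̃¹ ⊗ B̃²` is an `ε`-spectral approximation of `A¹ ⊗ A²` (stated
in both orders of the two Gram matrices); each `B̃ᵏ` has at most `C d log d / ε²` rows; and `B̃`
has at most `C d² (log d)² / ε⁴` rows. -/
structure Succeeds {n d : ℕ} (A₁ A₂ : Matrix (Fin n) (Fin d) ℝ) (C ε : ℝ)
    (B₁ B₂ : ℕ → RowSample n) : Prop where
  intermediate : ∀ ℓ : ℕ, 1 ≤ ℓ → ℓ ≤ numLevels n d →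
    ((B₁ ℓ).rows.card : ℝ) ≤ C * (d * Real.log d) ∧
      ((B₂ ℓ).rows.card : ℝ) ≤ C * (d * Real.log d)
  approx : SpectralApprox ε
    ((A₁ ⊗ₖ A₂)ᵀ * (A₁ ⊗ₖ A₂))
    (((B₁ 0).toMatrix A₁ ⊗ₖ (B₂ 0).toMatrix A₂)ᵀ * ((B₁ 0).toMatrix A₁ ⊗ₖ (B₂ 0).toMatrix A₂))
  approx' : SpectralApprox ε
    (((B₁ 0).toMatrix A₁ ⊗ₖ (B₂ 0).toMatrix A₂)ᵀ * ((B₁ 0).toMatrix A₁ ⊗ₖ (B₂ 0).toMatrix A₂))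
    ((A₁ ⊗ₖ A₂)ᵀ * (A₁ ⊗ₖ A₂))
  factor_rows : ((B₁ 0).rows.card : ℝ) ≤ C * (d * Real.log d / ε ^ 2) ∧
    ((B₂ 0).rows.card : ℝ) ≤ C * (d * Real.log d / ε ^ 2)
  output_rows : (Fintype.card ((B₁ 0).rows × (B₂ 0).rows) : ℝ) ≤
    C * ((d : ℝ) ^ 2 * Real.log d ^ 2 / ε ^ 4)

end Halving

end

noncomputable section

namespace Halving

/-! ### The Golden–Thompson inequality -/

section GoldenThompson

open Filter Topology NormedSpace

/-! The engine is a matrix Chernoff bound. Golden–Thompson bounds tr exp(M + z v vᵀ) by a function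
affine in exp(z |v|²), so revealing one independent coin at a time does not increase the mean of tr
exp as long as a scalar moment generating function is at most 1. With Markov's inequality this
controls the deviation of a rescaled row sample in all directions at once
(`bernoulliProb_deviation_le`). It is applied after whitening the rows of A_S, which turns ‖A_S x‖²
into a Euclidean norm and leverage scores into squared row norms of total at most d
(`exists_whitening`).

Two facts drive the recursion. First, a uniform half T of S dominates all but O(k₀) rows of S in
quadratic form, with high probability (`bernoulliProb_not_dominates_le`). Rows of high leverage are
revealed adaptively: a kept one stays heavy, so few can be kept, hence few are lost; the remaining
rows are light and obey Chernoff. Second, suppose B approximates the half A_{ℓ+1}. Its scores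
overestimate those of A_ℓ up to a constant, so sampling by them is accurate
(`weightedSample_approximates_le`). By domination they exceed the true scores by at most a constant
factor outside the few lost rows, so the expected sample size is O(d log d / ε²)
(`sum_sampleProb_le`).

Goodness of the chain depends on A alone, and each round uses fresh coins given the chain and the
earlier samples. A conditional union bound (`toOuterMeasure_bind_le`) therefore covers every
adaptive choice of weights. Each factor is approximated to accuracy ε/8, which leaves room for the
Kronecker product and for both orders of the approximation. For n ≤ d^K the factor L is at most d^K
and is absorbed by a larger exponent. -/

theorem norm_pow_sub_pow_le {𝔸 : Type*} [NormedRing 𝔸] [NormOneClass 𝔸] (x y : 𝔸) {M : ℝ}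
    (hM : 1 ≤ M) (hx : ‖x‖ ≤ M) (hy : ‖y‖ ≤ M) (n : ℕ) :
    ‖x ^ n - y ^ n‖ ≤ n * M ^ n * ‖x - y‖ := by
  have hM0 : 0 ≤ M := zero_le_one.trans hM
  induction n with
  | zero => simp
  | succ n ih =>
    have h1 : x ^ (n + 1) - y ^ (n + 1) = x * (x ^ n - y ^ n) + (x - y) * y ^ n := by
      rw [pow_succ', pow_succ']; noncomm_ring
    have h2 : ‖y ^ n‖ ≤ M ^ (n + 1) :=
      (norm_pow_le y n).trans ((pow_le_pow_left₀ (norm_nonneg _) hy n).trans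
        (pow_le_pow_right₀ hM n.le_succ))
    calc ‖x ^ (n + 1) - y ^ (n + 1)‖
        ≤ ‖x‖ * ‖x ^ n - y ^ n‖ + ‖x - y‖ * ‖y ^ n‖ := by
          rw [h1]; exact (norm_add_le _ _).trans (add_le_add (norm_mul_le _ _) (norm_mul_le _ _))
      _ ≤ M * (n * M ^ n * ‖x - y‖) + ‖x - y‖ * M ^ (n + 1) := by gcongr
      _ = _ := by push_cast; ring

theorem eventually_norm_le_of_hasDerivAt {𝔸 : Type*} [NormedRing 𝔸] [NormedAlgebra ℝ 𝔸]
    [NormOneClass 𝔸] {X : ℝ → 𝔸} {X' : 𝔸} (hX : HasDerivAt X X' 0) (h1 : X 0 = 1) :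
    ∃ K : ℝ, 0 ≤ K ∧ ∀ᶠ t in 𝓝 (0 : ℝ), ‖X t‖ ≤ 1 + K * |t| := by
  obtain ⟨K, hK⟩ := hX.isBigO_sub.bound
  refine ⟨|K|, abs_nonneg _, hK.mono fun t ht => ?_⟩
  rw [h1, sub_zero, Real.norm_eq_abs] at ht
  have h2 : ‖X t‖ ≤ ‖(1 : 𝔸)‖ + ‖X t - 1‖ := by
    simpa using norm_add_le (1 : 𝔸) (X t - 1)
  rw [norm_one] at h2
  have h3 : K * |t| ≤ |K| * |t| := mul_le_mul_of_nonneg_right (le_abs_self K) (abs_nonneg t)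
  linarith

/-- Lie product formula. -/
theorem tendsto_exp_mul_exp_pow {𝔸 : Type*} [NormedRing 𝔸] [NormedAlgebra ℝ 𝔸]
    [NormOneClass 𝔸] [CompleteSpace 𝔸] (A B : 𝔸) :
    Tendsto (fun n : ℕ => (exp ((n : ℝ)⁻¹ • A) * exp ((n : ℝ)⁻¹ • B)) ^ n) atTop
      (𝓝 (exp (A + B))) := by
  have hX : HasDerivAt (fun t : ℝ => exp (t • A) * exp (t • B)) (A + B) 0 := by
    have := (hasDerivAt_exp_smul_const (𝕂 := ℝ) A 0).mul
      (hasDerivAt_exp_smul_const (𝕂 := ℝ) B 0)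
    simp only [zero_smul, exp_zero, one_mul, mul_one] at this
    exact this
  have hY : HasDerivAt (fun t : ℝ => exp (t • (A + B))) (A + B) 0 := by
    simpa using hasDerivAt_exp_smul_const (𝕂 := ℝ) (A + B) 0
  obtain ⟨K, hK0, hK⟩ := eventually_norm_le_of_hasDerivAt hX (by simp)
  obtain ⟨K', hK'0, hK'⟩ := eventually_norm_le_of_hasDerivAt hY (by simp)
  -- The two curves agree to first order at 0, so at t = 1/n they differ by o(1/n), which survives
  -- the factor n lost in comparing n-th powers.
  have hD := hX.sub hY
  rw [sub_self, hasDerivAt_iff_isLittleO_nhds_zero] at hD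
  simp only [zero_add, smul_zero, sub_zero, zero_smul, exp_zero, mul_one, Pi.sub_apply,
    sub_self] at hD
  have hinv : Tendsto (fun n : ℕ => (n : ℝ)⁻¹) atTop (𝓝 0) :=
    tendsto_inv_atTop_zero.comp tendsto_natCast_atTop_atTop
  have hpow : ∀ n : ℕ, n ≠ 0 → exp ((n : ℝ)⁻¹ • (A + B)) ^ n = exp (A + B) := by
    intro n hn
    let : NormedAlgebra ℚ 𝔸 := NormedAlgebra.restrictScalars ℚ ℝ 𝔸
    rw [← exp_nsmul, ← Nat.cast_smul_eq_nsmul ℝ, smul_smul,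
      mul_inv_cancel₀ (Nat.cast_ne_zero.mpr hn), one_smul]
  rw [tendsto_iff_norm_sub_tendsto_zero]
  set E := Real.exp (max K K') with hE
  have hlim : Tendsto (fun n : ℕ => E * (‖exp ((n : ℝ)⁻¹ • A) * exp ((n : ℝ)⁻¹ • B) -
      exp ((n : ℝ)⁻¹ • (A + B))‖ / ‖(n : ℝ)⁻¹‖)) atTop (𝓝 0) := by
    have := ((hD.norm_norm.tendsto_div_nhds_zero).comp hinv).const_mul E
    simpa using this
  refine squeeze_zero' (Eventually.of_forall fun _ => norm_nonneg _) ?_ hlim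
  filter_upwards [hinv.eventually hK, hinv.eventually hK', eventually_gt_atTop 0] with n h1 h2 hn
  have hn' : (0 : ℝ) < n := Nat.cast_pos.mpr hn
  have hpos : (0 : ℝ) < (n : ℝ)⁻¹ := inv_pos.mpr hn'
  rw [abs_of_pos hpos] at h1 h2
  -- Both norms are at most 1 + O(1/n), so their n-th powers stay bounded.
  have hM : (1 + max K K' * (n : ℝ)⁻¹) ^ n ≤ E := by
    calc (1 + max K K' * (n : ℝ)⁻¹) ^ n ≤ (Real.exp (max K K' * (n : ℝ)⁻¹)) ^ n := by
          have := Real.add_one_le_exp (max K K' * (n : ℝ)⁻¹)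
          have h0 : 0 ≤ max K K' := le_max_of_le_left hK0
          gcongr
          linarith
      _ = E := by rw [← Real.exp_nat_mul, hE]; congr 1; field_simp
  rw [← hpow n hn.ne']
  refine (norm_pow_sub_pow_le (M := 1 + max K K' * (n : ℝ)⁻¹) _ _ ?_ (h1.trans ?_)
    (h2.trans ?_) n).trans ?_
  · have h0 : 0 ≤ max K K' := le_max_of_le_left hK0
    have := mul_nonneg h0 hpos.le
    linarith
  · gcongr; exact le_max_left _ _
  · gcongr; exact le_max_right _ _
  · rw [Real.norm_of_nonneg hpos.le, div_inv_eq_mul]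
    calc _ ≤ (n : ℝ) * E * ‖exp ((n : ℝ)⁻¹ • A) * exp ((n : ℝ)⁻¹ • B) -
          exp ((n : ℝ)⁻¹ • (A + B))‖ := by gcongr
      _ = _ := by ring

variable {m : Type*} [Fintype m] [DecidableEq m]

theorem trace_mul_pow_comm (A B : Matrix m m ℝ) (n : ℕ) :
    ((A * B) ^ n).trace = ((B * A) ^ n).trace := by
  cases n with
  | zero => simp
  | succ n =>
    have h : ∀ k : ℕ, (A * B) ^ k * A = A * (B * A) ^ k := by
      intro k
      induction k with
      | zero => simp
      | succ k ih => rw [pow_succ', Matrix.mul_assoc, ih, pow_succ']; simp only [Matrix.mul_assoc]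
    rw [pow_succ, ← Matrix.mul_assoc, h, Matrix.mul_assoc, Matrix.trace_mul_comm, pow_succ,
      Matrix.mul_assoc]

theorem trace_mul_le_trace_sq (A B : Matrix m m ℝ) :
    2 * (Aᵀ * B).trace ≤ (Aᵀ * A).trace + (Bᵀ * B).trace := by
  have h : 0 ≤ ((A - B)ᵀ * (A - B)).trace := by
    rw [Matrix.trace]
    refine Finset.sum_nonneg fun i _ => ?_
    rw [Matrix.diag_apply, Matrix.mul_apply]
    exact Finset.sum_nonneg fun j _ => mul_self_nonneg _
  have h2 : (Bᵀ * A).trace = (Aᵀ * B).trace := by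
    rw [← Matrix.trace_transpose, Matrix.transpose_mul, Matrix.transpose_transpose]
  have h3 : (A - B)ᵀ * (A - B) = Aᵀ * A - Aᵀ * B - Bᵀ * A + Bᵀ * B := by
    rw [Matrix.transpose_sub]; noncomm_ring
  rw [h3, Matrix.trace_add, Matrix.trace_sub, Matrix.trace_sub, h2] at h
  linarith

/-- The two claims feed each other. Applying the second to X = AB and cycling the trace gives tr
(A²B²)^(2^k), to which the first applies. Conversely, X² reduces to the product of XᵀX and XXᵀ,
whose powers have equal traces, and AM–GM for the trace finishes. -/
theorem trace_pow_two_pow_le (k : ℕ) :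
    (∀ A B : Matrix m m ℝ, Aᵀ = A → Bᵀ = B →
      ((A * B) ^ 2 ^ k).trace ≤ (A ^ 2 ^ k * B ^ 2 ^ k).trace) ∧
    ∀ X : Matrix m m ℝ, (X ^ 2 ^ (k + 1)).trace ≤ ((Xᵀ * X) ^ 2 ^ k).trace := by
  induction k with
  | zero =>
    refine ⟨fun A B _ _ => by simp, fun X => ?_⟩
    have h := trace_mul_le_trace_sq Xᵀ X
    rw [Matrix.transpose_transpose, Matrix.trace_mul_comm X Xᵀ] at h
    simp only [zero_add, pow_one, pow_zero, sq]
    linarith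
  | succ k ih =>
    obtain ⟨ihA, ihX⟩ := ih
    have hA : ∀ A B : Matrix m m ℝ, Aᵀ = A → Bᵀ = B →
        ((A * B) ^ 2 ^ (k + 1)).trace ≤ (A ^ 2 ^ (k + 1) * B ^ 2 ^ (k + 1)).trace := by
      intro A B hA hB
      refine (ihX _).trans ?_
      have h1 : (A * B)ᵀ * (A * B) = B * (A ^ 2 * B) := by
        rw [Matrix.transpose_mul, hA, hB, sq]; simp only [Matrix.mul_assoc]
      rw [h1, trace_mul_pow_comm, Matrix.mul_assoc, ← sq B, pow_succ' 2 k, pow_mul, pow_mul]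
      exact ihA _ _ (by rw [Matrix.transpose_pow, hA]) (by rw [Matrix.transpose_pow, hB])
    refine ⟨hA, fun X => ?_⟩
    have h1 : (X ^ 2 ^ (k + 1 + 1)).trace ≤ (((X ^ 2)ᵀ * X ^ 2) ^ 2 ^ k).trace := by
      rw [pow_succ' 2 (k + 1), pow_mul]
      exact (ihX (X ^ 2)).trans (by rfl)
    have h2 : (X ^ 2)ᵀ * X ^ 2 = Xᵀ * (Xᵀ * X * X) := by
      rw [Matrix.transpose_pow, sq, sq]; simp only [Matrix.mul_assoc]
    have h3 : Xᵀ * X * X * Xᵀ = (Xᵀ * X) * (X * Xᵀ) := by simp only [Matrix.mul_assoc]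
    have hs1 : (Xᵀ * X)ᵀ = Xᵀ * X := by rw [Matrix.transpose_mul, Matrix.transpose_transpose]
    have hs2 : (X * Xᵀ)ᵀ = X * Xᵀ := by rw [Matrix.transpose_mul, Matrix.transpose_transpose]
    have h4 := ihA _ _ hs1 hs2
    have h5 := trace_mul_le_trace_sq ((Xᵀ * X) ^ 2 ^ k) ((X * Xᵀ) ^ 2 ^ k)
    rw [Matrix.transpose_pow, Matrix.transpose_pow, hs1, hs2, ← sq, ← sq, ← pow_mul, ← pow_mul,
      ← pow_succ, trace_mul_pow_comm X Xᵀ] at h5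
    rw [h2, trace_mul_pow_comm, h3] at h1
    linarith

theorem trace_exp_add_le (A B : Matrix m m ℝ) (hA : Aᵀ = A) (hB : Bᵀ = B) :
    (exp (A + B)).trace ≤ (exp A * exp B).trace := by
  rcases isEmpty_or_nonempty m with hm | hm
  · simp [Matrix.trace]
  let : NormedRing (Matrix m m ℝ) := Matrix.linftyOpNormedRing
  let : NormedAlgebra ℝ (Matrix m m ℝ) := Matrix.linftyOpNormedAlgebra
  have : NormOneClass (Matrix m m ℝ) := Matrix.linfty_opNormOneClass
  -- Only powers of two are needed in the Lie product formula, and these are the exponents covered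
  -- by `trace_pow_two_pow_le`.
  have h := (tendsto_exp_mul_exp_pow A B).comp (tendsto_pow_atTop_atTop_of_one_lt one_lt_two)
  have htr : Continuous (Matrix.trace : Matrix m m ℝ → ℝ) := by fun_prop
  refine le_of_tendsto ((htr.tendsto _).comp h) (Eventually.of_forall fun k => ?_)
  have hN : ((2 ^ k : ℕ) : ℝ) ≠ 0 := by positivity
  have hs : ∀ M : Matrix m m ℝ, exp ((((2 ^ k : ℕ) : ℝ))⁻¹ • M) ^ 2 ^ k = exp M := by
    intro M
    rw [← Matrix.exp_nsmul, ← Nat.cast_smul_eq_nsmul ℝ, smul_smul, mul_inv_cancel₀ hN, one_smul]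
  have h2 := (trace_pow_two_pow_le k).1 (exp ((((2 ^ k : ℕ) : ℝ))⁻¹ • A))
    (exp ((((2 ^ k : ℕ) : ℝ))⁻¹ • B))
    (by rw [← Matrix.exp_transpose, Matrix.transpose_smul, hA])
    (by rw [← Matrix.exp_transpose, Matrix.transpose_smul, hB])
  rw [hs, hs] at h2
  exact h2

end GoldenThompson

/-! ### Trace exponentials and random rank-one updates -/

section TraceExp

open NormedSpace

variable {m : Type*} [Fintype m] [DecidableEq m]

theorem exists_spectral (D : Matrix m m ℝ) (hD : Dᵀ = D) :
    ∃ (U : Matrix m m ℝ) (e : m → ℝ), Uᵀ * U = 1 ∧ U * Uᵀ = 1 ∧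
      D = U * Matrix.diagonal e * Uᵀ := by
  have hH : D.IsHermitian := by
    rw [Matrix.IsHermitian, Matrix.conjTranspose_eq_transpose_of_trivial, hD]
  refine ⟨hH.eigenvectorUnitary, hH.eigenvalues, ?_, ?_, ?_⟩
  · have h := Unitary.coe_star_mul_self hH.eigenvectorUnitary
    rwa [Matrix.star_eq_conjTranspose, Matrix.conjTranspose_eq_transpose_of_trivial] at h
  · have h := Unitary.mul_star_self_of_mem hH.eigenvectorUnitary.2
    rwa [Matrix.star_eq_conjTranspose, Matrix.conjTranspose_eq_transpose_of_trivial] at h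
  · have h := hH.spectral_theorem
    rw [Unitary.conjStarAlgAut_apply, Matrix.star_eq_conjTranspose,
      Matrix.conjTranspose_eq_transpose_of_trivial] at h
    exact h

theorem trace_exp_of_spectral {U : Matrix m m ℝ} {e : m → ℝ} (h1 : Uᵀ * U = 1)
    (h2 : U * Uᵀ = 1) :
    (exp (U * Matrix.diagonal e * Uᵀ)).trace = ∑ k, Real.exp (e k) := by
  have hinv : U⁻¹ = Uᵀ := Matrix.inv_eq_right_inv h2
  have hU : IsUnit U := (Matrix.isUnit_iff_isUnit_det U).mpr (Matrix.isUnit_det_of_right_inverse h2)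
  rw [← hinv, Matrix.exp_conj _ _ hU, Matrix.trace_mul_comm, ← Matrix.mul_assoc, hinv, h1,
    Matrix.one_mul, Matrix.exp_diagonal, Matrix.trace_diagonal]
  refine Finset.sum_congr rfl fun k _ => ?_
  rw [Pi.coe_exp, ← Real.exp_eq_exp_ℝ]

theorem dotProduct_spectral_mulVec (U : Matrix m m ℝ) (e : m → ℝ) (y : m → ℝ) :
    y ⬝ᵥ ((U * Matrix.diagonal e * Uᵀ) *ᵥ y) = ∑ k, e k * (Uᵀ *ᵥ y) k ^ 2 := by
  rw [← Matrix.mulVec_mulVec, ← Matrix.mulVec_mulVec, Matrix.dotProduct_mulVec,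
    ← Matrix.mulVec_transpose, dotProduct]
  refine Finset.sum_congr rfl fun k _ => ?_
  rw [Matrix.mulVec_diagonal]; ring

theorem dotProduct_transpose_mulVec_self {U : Matrix m m ℝ} (h2 : U * Uᵀ = 1) (y : m → ℝ) :
    ∑ k, (Uᵀ *ᵥ y) k ^ 2 = y ⬝ᵥ y := by
  have h := dotProduct_spectral_mulVec U 1 y
  rw [show Matrix.diagonal (1 : m → ℝ) = 1 from Matrix.diagonal_one, Matrix.mul_one, h2,
    Matrix.one_mulVec] at h
  simp [h]

theorem trace_exp_le_card_mul (D : Matrix m m ℝ) (hD : Dᵀ = D) {a : ℝ}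
    (h : ∀ y, y ⬝ᵥ (D *ᵥ y) ≤ a * (y ⬝ᵥ y)) :
    (exp D).trace ≤ Fintype.card m * Real.exp a := by
  obtain ⟨U, e, h1, h2, rfl⟩ := exists_spectral D hD
  rw [trace_exp_of_spectral h1 h2]
  have hk : ∀ k, e k ≤ a := by
    intro k
    have h3 := h (U *ᵥ Pi.single k 1)
    rw [dotProduct_spectral_mulVec, ← dotProduct_transpose_mulVec_self h2,
      Matrix.mulVec_mulVec, h1, Matrix.one_mulVec] at h3
    simpa [Pi.single_apply] using h3
  calc ∑ k, Real.exp (e k) ≤ ∑ _k : m, Real.exp a :=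
        Finset.sum_le_sum fun k _ => Real.exp_le_exp.mpr (hk k)
    _ = _ := by simp

/-- A direction violating the bound a forces an eigenvalue at least a. This turns a deviation event
into a lower bound on tr exp, ready for Markov's inequality. -/
theorem exp_le_trace_exp (D : Matrix m m ℝ) (hD : Dᵀ = D) {a : ℝ} (y : m → ℝ)
    (h : a * (y ⬝ᵥ y) < y ⬝ᵥ (D *ᵥ y)) : Real.exp a ≤ (exp D).trace := by
  obtain ⟨U, e, h1, h2, rfl⟩ := exists_spectral D hD
  rw [trace_exp_of_spectral h1 h2]
  rw [dotProduct_spectral_mulVec, ← dotProduct_transpose_mulVec_self h2, Finset.mul_sum] at h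
  obtain ⟨k, -, hk⟩ := Finset.exists_lt_of_sum_lt h
  have hak : a ≤ e k := le_of_not_gt fun hlt =>
    absurd hk (not_lt.mpr (mul_le_mul_of_nonneg_right hlt.le (sq_nonneg _)))
  exact (Real.exp_le_exp.mpr hak).trans
    (Finset.single_le_sum (f := fun k => Real.exp (e k)) (fun _ _ => (Real.exp_pos _).le)
      (Finset.mem_univ k))

theorem exp_smul_of_isIdempotentElem {P : Matrix m m ℝ} (hP : P * P = P) (y : ℝ) :
    exp (y • P) = 1 + (Real.exp y - 1) • P := by
  let _ : NormedRing (Matrix m m ℝ) := Matrix.linftyOpNormedRing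
  let _ : NormedAlgebra ℝ (Matrix m m ℝ) := Matrix.linftyOpNormedAlgebra
  have h1 := exp_series_hasSum_exp' (𝕂 := ℝ) (y • P)
  have h2 : HasSum (fun n : ℕ => ((n.factorial : ℝ)⁻¹ * y ^ n) • P + if n = 0 then 1 - P else 0)
      (Real.exp y • P + (1 - P)) := by
    have h3 := (exp_series_hasSum_exp' (𝕂 := ℝ) y).smul_const P
    simp only [smul_eq_mul] at h3
    rw [← Real.exp_eq_exp_ℝ] at h3
    exact h3.add (hasSum_ite_eq 0 (1 - P))
  have h4 : (fun n : ℕ => (n.factorial : ℝ)⁻¹ • (y • P) ^ n) =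
      fun n : ℕ => ((n.factorial : ℝ)⁻¹ * y ^ n) • P + if n = 0 then 1 - P else 0 := by
    funext n
    cases n with
    | zero => simp
    | succ n =>
      have hpow : P ^ (n + 1) = P := IsIdempotentElem.pow_succ_eq n hP
      rw [smul_pow, hpow, smul_smul]; simp
  rw [h4] at h1
  refine (h1.unique h2).trans ?_
  rw [sub_smul, one_smul]
  abel

/-- v vᵀ / |v|² is a projection. For v = 0 both sides are 1, by the convention for division by zero.
-/
theorem exp_smul_vecMulVec (v : m → ℝ) (x : ℝ) :
    exp (x • Matrix.vecMulVec v v) =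
      1 + ((Real.exp (x * (v ⬝ᵥ v)) - 1) / (v ⬝ᵥ v)) • Matrix.vecMulVec v v := by
  rcases eq_or_ne (v ⬝ᵥ v) 0 with h | h
  · rw [dotProduct_self_eq_zero] at h
    simp [h]
  · have hP : ((v ⬝ᵥ v)⁻¹ • Matrix.vecMulVec v v) * ((v ⬝ᵥ v)⁻¹ • Matrix.vecMulVec v v) =
        (v ⬝ᵥ v)⁻¹ • Matrix.vecMulVec v v := by
      rw [Matrix.smul_mul, Matrix.mul_smul, Matrix.vecMulVec_mul_vecMulVec,
        Matrix.vecMulVec_smul, smul_smul, smul_smul]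
      congr 1
      field_simp
    have h2 := exp_smul_of_isIdempotentElem hP (x * (v ⬝ᵥ v))
    rw [smul_smul, smul_smul, mul_assoc, mul_inv_cancel₀ h, mul_one] at h2
    rw [h2, div_eq_mul_inv]

theorem trace_exp_mul_vecMulVec_nonneg (M : Matrix m m ℝ) (hM : Mᵀ = M) (v : m → ℝ) :
    0 ≤ (exp M * Matrix.vecMulVec v v).trace := by
  have h1 : exp M = (exp ((2 : ℝ)⁻¹ • M))ᵀ * exp ((2 : ℝ)⁻¹ • M) := by
    rw [← Matrix.exp_transpose, Matrix.transpose_smul, hM, ← sq, ← Matrix.exp_nsmul,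
      ← Nat.cast_smul_eq_nsmul ℝ, smul_smul]
    norm_num
  rw [h1, Matrix.mul_vecMulVec, Matrix.trace_vecMulVec, ← Matrix.mulVec_mulVec,
    Matrix.mulVec_transpose, ← Matrix.dotProduct_mulVec]
  exact Finset.sum_nonneg fun i _ => mul_self_nonneg _

/-- After Golden–Thompson the dependence on z is affine in exp(z |v|²), with the nonnegative slope
tr(exp M · v vᵀ) / |v|². So the scalar hypothesis suffices. -/
theorem mean_trace_exp_add_le (M : Matrix m m ℝ) (hM : Mᵀ = M) (v : m → ℝ) {p x y : ℝ}
    (hp0 : 0 ≤ p) (hp1 : p ≤ 1)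
    (h : p * Real.exp (x * (v ⬝ᵥ v)) + (1 - p) * Real.exp (y * (v ⬝ᵥ v)) ≤ 1) :
    p * (exp (M + x • Matrix.vecMulVec v v)).trace +
      (1 - p) * (exp (M + y • Matrix.vecMulVec v v)).trace ≤ (exp M).trace := by
  have key : ∀ z : ℝ, (exp (M + z • Matrix.vecMulVec v v)).trace ≤ (exp M).trace +
      (Real.exp (z * (v ⬝ᵥ v)) - 1) / (v ⬝ᵥ v) * (exp M * Matrix.vecMulVec v v).trace := by
    intro z
    refine (trace_exp_add_le M _ hM (by
      rw [Matrix.transpose_smul, Matrix.transpose_vecMulVec])).trans (le_of_eq ?_)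
    rw [exp_smul_vecMulVec, Matrix.mul_add, Matrix.mul_one, Matrix.trace_add, Matrix.mul_smul,
      Matrix.trace_smul, smul_eq_mul]
  have hq := trace_exp_mul_vecMulVec_nonneg M hM v
  have hs : 0 ≤ v ⬝ᵥ v := Finset.sum_nonneg fun i _ => mul_self_nonneg _
  set q := (exp M * Matrix.vecMulVec v v).trace
  set s := v ⬝ᵥ v
  have h1 := mul_le_mul_of_nonneg_left (key x) hp0
  have h2 := mul_le_mul_of_nonneg_left (key y) (sub_nonneg.mpr hp1)
  have h3 : (p * Real.exp (x * s) + (1 - p) * Real.exp (y * s) - 1) / s * q ≤ 0 :=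
    mul_nonpos_of_nonpos_of_nonneg (div_nonpos_of_nonpos_of_nonneg (by linarith) hs) hq
  have h4 : (p * Real.exp (x * s) + (1 - p) * Real.exp (y * s) - 1) / s * q =
      p * ((Real.exp (x * s) - 1) / s * q) + (1 - p) * ((Real.exp (y * s) - 1) / s * q) := by ring
  linarith

end TraceExp

/-! ### Expectations over a random subset -/

section BernoulliMean

variable {n : ℕ}

/-- The expectation of `f T` when `T ⊆ S` contains each `i ∈ S` independently with
probability `p i`. -/
def bernoulliMean (S : Finset (Fin n)) (p : Fin n → ℝ) (f : Finset (Fin n) → ℝ) : ℝ :=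
  ∑ T ∈ S.powerset, ((∏ i ∈ T, p i) * ∏ i ∈ S \ T, (1 - p i)) * f T

theorem bernoulliMean_empty (p : Fin n → ℝ) (f : Finset (Fin n) → ℝ) :
    bernoulliMean ∅ p f = f ∅ := by
  simp [bernoulliMean]

theorem bernoulliMean_insert {S : Finset (Fin n)} {i : Fin n} (hi : i ∉ S) (p : Fin n → ℝ)
    (f : Finset (Fin n) → ℝ) :
    bernoulliMean (insert i S) p f =
      p i * bernoulliMean S p (fun T => f (insert i T)) + (1 - p i) * bernoulliMean S p f := by
  unfold bernoulliMean
  rw [Finset.sum_powerset_insert hi, add_comm, Finset.mul_sum, Finset.mul_sum]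
  congr 1
  · refine Finset.sum_congr rfl fun T hT => ?_
    have hiT : i ∉ T := fun h => hi (Finset.mem_powerset.mp hT h)
    have h2 : insert i S \ insert i T = S \ T := by
      rw [Finset.insert_sdiff_insert, Finset.sdiff_insert_of_notMem hi]
    rw [Finset.prod_insert hiT, h2]; ring
  · refine Finset.sum_congr rfl fun T hT => ?_
    have hiT : i ∉ T := fun h => hi (Finset.mem_powerset.mp hT h)
    rw [Finset.insert_sdiff_of_notMem _ hiT,
      Finset.prod_insert (fun h => hi (Finset.mem_sdiff.mp h).1)]
    ring

theorem bernoulliMean_const (S : Finset (Fin n)) (p : Fin n → ℝ) (a : ℝ) :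
    bernoulliMean S p (fun _ => a) = a := by
  unfold bernoulliMean
  rw [← Finset.sum_mul, ← Finset.prod_add]
  simp

theorem bernoulliMean_add (S : Finset (Fin n)) (p : Fin n → ℝ) (f g : Finset (Fin n) → ℝ) :
    bernoulliMean S p (fun T => f T + g T) = bernoulliMean S p f + bernoulliMean S p g := by
  simp only [bernoulliMean, mul_add, Finset.sum_add_distrib]

theorem bernoulliMean_const_mul (S : Finset (Fin n)) (p : Fin n → ℝ) (a : ℝ)
    (f : Finset (Fin n) → ℝ) :
    bernoulliMean S p (fun T => a * f T) = a * bernoulliMean S p f := by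
  simp only [bernoulliMean, Finset.mul_sum]
  exact Finset.sum_congr rfl fun _ _ => by ring

theorem bernoulliMean_mono {S : Finset (Fin n)} {p : Fin n → ℝ} (hp0 : ∀ i, 0 ≤ p i)
    (hp1 : ∀ i, p i ≤ 1) {f g : Finset (Fin n) → ℝ} (h : ∀ T ⊆ S, f T ≤ g T) :
    bernoulliMean S p f ≤ bernoulliMean S p g :=
  Finset.sum_le_sum fun T hT => mul_le_mul_of_nonneg_left (h T (Finset.mem_powerset.mp hT))
    (mul_nonneg (Finset.prod_nonneg fun i _ => hp0 i)
      (Finset.prod_nonneg fun i _ => sub_nonneg.mpr (hp1 i)))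

open Classical in
/-- The probability of the event `E` for the random subset of `bernoulliMean`. -/
def bernoulliProb (S : Finset (Fin n)) (p : Fin n → ℝ) (E : Finset (Fin n) → Prop) : ℝ :=
  bernoulliMean S p fun T => if E T then 1 else 0

theorem bernoulliProb_insert {S : Finset (Fin n)} {i : Fin n} (hi : i ∉ S) (p : Fin n → ℝ)
    (E : Finset (Fin n) → Prop) :
    bernoulliProb (insert i S) p E =
      p i * bernoulliProb S p (fun T => E (insert i T)) + (1 - p i) * bernoulliProb S p E :=
  bernoulliMean_insert hi p _

theorem bernoulliProb_le_mean {S : Finset (Fin n)} {p : Fin n → ℝ} (hp0 : ∀ i, 0 ≤ p i)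
    (hp1 : ∀ i, p i ≤ 1) {E : Finset (Fin n) → Prop} {f : Finset (Fin n) → ℝ}
    (hf : ∀ T, 0 ≤ f T) (h : ∀ T ⊆ S, E T → 1 ≤ f T) :
    bernoulliProb S p E ≤ bernoulliMean S p f := by
  refine bernoulliMean_mono hp0 hp1 fun T hT => ?_
  split_ifs with hE
  · exact h T hT hE
  · exact hf T

theorem bernoulliProb_mono {S : Finset (Fin n)} {p : Fin n → ℝ} (hp0 : ∀ i, 0 ≤ p i)
    (hp1 : ∀ i, p i ≤ 1) {E F : Finset (Fin n) → Prop} (h : ∀ T ⊆ S, E T → F T) :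
    bernoulliProb S p E ≤ bernoulliProb S p F := by
  refine bernoulliProb_le_mean hp0 hp1 (fun T => by split_ifs <;> norm_num) fun T hT hE => ?_
  rw [if_pos (h T hT hE)]

theorem bernoulliProb_le_one {S : Finset (Fin n)} {p : Fin n → ℝ} (hp0 : ∀ i, 0 ≤ p i)
    (hp1 : ∀ i, p i ≤ 1) (E : Finset (Fin n) → Prop) : bernoulliProb S p E ≤ 1 :=
  (bernoulliProb_le_mean hp0 hp1 (f := fun _ => 1) (fun _ => zero_le_one)
    fun _ _ _ => le_rfl).trans (bernoulliMean_const S p 1).le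

theorem bernoulliProb_or_le {S : Finset (Fin n)} {p : Fin n → ℝ} (hp0 : ∀ i, 0 ≤ p i)
    (hp1 : ∀ i, p i ≤ 1) (E F : Finset (Fin n) → Prop) :
    bernoulliProb S p (fun T => E T ∨ F T) ≤ bernoulliProb S p E + bernoulliProb S p F := by
  classical
  unfold bernoulliProb
  rw [← bernoulliMean_add]
  refine bernoulliMean_mono hp0 hp1 fun T _ => ?_
  by_cases hE : E T <;> by_cases hF : F T <;> simp [hE, hF]

theorem tsum_bernoulliSubset_mul (S : Finset (Fin n)) (p : Fin n → ℝ≥0∞)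
    (hp : ∀ i, p i ≤ 1) {f : Finset (Fin n) → ℝ} (hf : ∀ T, 0 ≤ f T) :
    ∑' T, bernoulliSubset S p hp T * ENNReal.ofReal (f T) =
      ENNReal.ofReal (bernoulliMean S (fun i => (p i).toReal) f) := by
  have hp0 : ∀ i, 0 ≤ (p i).toReal := fun i => ENNReal.toReal_nonneg
  have hp1 : ∀ i, (p i).toReal ≤ 1 := fun i => ENNReal.toReal_le_of_le_ofReal zero_le_one
    (by simpa using hp i)
  have hprod : ∀ T : Finset (Fin n), 0 ≤ (∏ i ∈ T, (p i).toReal) *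
      ∏ i ∈ S \ T, (1 - (p i).toReal) := fun T =>
    mul_nonneg (Finset.prod_nonneg fun i _ => hp0 i)
      (Finset.prod_nonneg fun i _ => sub_nonneg.mpr (hp1 i))
  rw [bernoulliMean, ENNReal.ofReal_sum_of_nonneg fun T _ => mul_nonneg (hprod T) (hf T),
    tsum_eq_sum (s := S.powerset)]
  · refine Finset.sum_congr rfl fun T hT => ?_
    rw [bernoulliSubset, PMF.ofFinset_apply, if_pos (Finset.mem_powerset.mp hT),
      ENNReal.ofReal_mul (hprod T), ENNReal.ofReal_mul (Finset.prod_nonneg fun i _ => hp0 i),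
      ENNReal.ofReal_prod_of_nonneg (fun i _ => hp0 i),
      ENNReal.ofReal_prod_of_nonneg (fun i _ => sub_nonneg.mpr (hp1 i))]
    congr 2
    · exact Finset.prod_congr rfl fun i _ =>
        (ENNReal.ofReal_toReal ((hp i).trans_lt ENNReal.one_lt_top).ne).symm
    · refine Finset.prod_congr rfl fun i _ => ?_
      rw [ENNReal.ofReal_sub _ (hp0 i), ENNReal.ofReal_one,
        ENNReal.ofReal_toReal ((hp i).trans_lt ENNReal.one_lt_top).ne]
  · intro T hT
    rw [bernoulliSubset, PMF.ofFinset_apply, if_neg fun h => hT (Finset.mem_powerset.mpr h),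
      zero_mul]

theorem toOuterMeasure_bernoulliSubset (S : Finset (Fin n)) (p : Fin n → ℝ≥0∞)
    (hp : ∀ i, p i ≤ 1) (E : Finset (Fin n) → Prop) :
    (bernoulliSubset S p hp).toOuterMeasure {T | E T} =
      ENNReal.ofReal (bernoulliProb S (fun i => (p i).toReal) E) := by
  classical
  rw [bernoulliProb, ← tsum_bernoulliSubset_mul S p hp (fun T => by split_ifs <;> norm_num),
    PMF.toOuterMeasure_apply]
  refine tsum_congr fun T => ?_
  by_cases hE : E T <;> simp [hE]

theorem bernoulliMean_exp_card_le (S : Finset (Fin n)) {p : Fin n → ℝ} (hp0 : ∀ i, 0 ≤ p i)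
    (hp1 : ∀ i, p i ≤ 1) :
    bernoulliMean S p (fun T => Real.exp T.card) ≤ Real.exp (2 * ∑ i ∈ S, p i) := by
  induction S using Finset.induction_on with
  | empty => simp [bernoulliMean_empty]
  | insert i S hi ih =>
    rw [bernoulliMean_insert hi, Finset.sum_insert hi]
    have h1 : bernoulliMean S p (fun T => Real.exp (insert i T).card) ≤
        Real.exp 1 * bernoulliMean S p (fun T => Real.exp T.card) := by
      rw [← bernoulliMean_const_mul]
      refine bernoulliMean_mono hp0 hp1 fun T hT => ?_
      rw [Finset.card_insert_of_notMem fun h => hi (hT h), ← Real.exp_add]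
      push_cast
      rw [add_comm]
    have hm : 0 ≤ bernoulliMean S p (fun T => Real.exp T.card) := by
      rw [← bernoulliMean_const S p 0]
      exact bernoulliMean_mono hp0 hp1 fun _ _ => (Real.exp_pos _).le
    calc _ ≤ (p i * Real.exp 1 + (1 - p i)) * bernoulliMean S p (fun T => Real.exp T.card) := by
          nlinarith [mul_le_mul_of_nonneg_left h1 (hp0 i)]
      _ ≤ Real.exp (2 * p i) * Real.exp (2 * ∑ i ∈ S, p i) := by
          -- Each coin contributes 1 + p(e − 1) ≤ 1 + 2p ≤ exp(2p).
          have he : Real.exp 1 ≤ 3 := by linarith [Real.exp_one_lt_d9]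
          have h2 := Real.add_one_le_exp (2 * p i)
          have h3 := mul_le_mul_of_nonneg_left he (hp0 i)
          exact mul_le_mul (by linarith) ih hm (Real.exp_pos _).le
      _ = _ := by rw [← Real.exp_add]; congr 1; ring

theorem bernoulliProb_card_gt_le (S : Finset (Fin n)) {p : Fin n → ℝ} (hp0 : ∀ i, 0 ≤ p i)
    (hp1 : ∀ i, p i ≤ 1) {μ : ℝ} (h : ∑ i ∈ S, p i ≤ μ) :
    bernoulliProb S p (fun T => 3 * μ < T.card) ≤ Real.exp (-μ) := by
  have h1 : bernoulliProb S p (fun T => 3 * μ < T.card) ≤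
      bernoulliMean S p (fun T => Real.exp (-(3 * μ)) * Real.exp T.card) := by
    refine bernoulliProb_le_mean hp0 hp1 (fun T => by positivity) fun T _ hT => ?_
    rw [← Real.exp_add, Real.one_le_exp_iff]
    linarith
  refine h1.trans ?_
  rw [bernoulliMean_const_mul]
  calc _ ≤ Real.exp (-(3 * μ)) * Real.exp (2 * μ) := by
        gcongr
        exact (bernoulliMean_exp_card_le S hp0 hp1).trans (Real.exp_le_exp.mpr (by linarith))
    _ = _ := by rw [← Real.exp_add]; congr 1; ring

/-! ### Matrix concentration for random row samples -/

section MatrixConcentration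

open NormedSpace

variable {d : ℕ}

/-- Induction over the coins; M is general because it absorbs the rows already revealed. -/
theorem bernoulliMean_trace_exp_le (S : Finset (Fin n)) {p : Fin n → ℝ} (hp0 : ∀ i, 0 ≤ p i)
    (hp1 : ∀ i, p i ≤ 1) (v : Fin n → Fin d → ℝ) (x y : Fin n → ℝ)
    (h : ∀ i ∈ S, p i * Real.exp (x i * (v i ⬝ᵥ v i)) +
      (1 - p i) * Real.exp (y i * (v i ⬝ᵥ v i)) ≤ 1)
    (M : Matrix (Fin d) (Fin d) ℝ) (hM : Mᵀ = M) :
    bernoulliMean S p (fun T => (exp (M + ∑ i ∈ S, (if i ∈ T then x i else y i) •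
      Matrix.vecMulVec (v i) (v i))).trace) ≤ (exp M).trace := by
  induction S using Finset.induction_on generalizing M with
  | empty => simp [bernoulliMean_empty]
  | insert i S hi ih =>
    have hS := ih fun j hj => h j (Finset.mem_insert_of_mem hj)
    have hMz : ∀ z : ℝ, (M + z • Matrix.vecMulVec (v i) (v i))ᵀ =
        M + z • Matrix.vecMulVec (v i) (v i) := by
      intro z
      rw [Matrix.transpose_add, Matrix.transpose_smul, Matrix.transpose_vecMulVec, hM]
    rw [bernoulliMean_insert hi]
    refine le_trans (add_le_add (mul_le_mul_of_nonneg_left (le_trans ?_ (hS _ (hMz (x i))))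
      (hp0 i)) (mul_le_mul_of_nonneg_left (le_trans ?_ (hS _ (hMz (y i))))
      (sub_nonneg.mpr (hp1 i)))) (mean_trace_exp_add_le M hM (v i) (hp0 i) (hp1 i)
        (h i (Finset.mem_insert_self i S)))
    · refine bernoulliMean_mono hp0 hp1 fun T hT => le_of_eq ?_
      rw [Finset.sum_insert hi, if_pos (Finset.mem_insert_self i T), ← add_assoc]
      congr 3
      refine Finset.sum_congr rfl fun j hj => ?_
      have hji : j ≠ i := fun hji => hi (hji ▸ hj)
      simp [Finset.mem_insert, hji]
    · refine bernoulliMean_mono hp0 hp1 fun T hT => le_of_eq ?_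
      rw [Finset.sum_insert hi, if_neg (fun h => hi (hT h)), ← add_assoc]

/-- The centered variable has mean 0 and variance at most δ s, so its moment generating function is
at most exp(t² δ s). The compensator −t² δ cancels this exactly. If p = 0, the hypothesis forces s =
0. -/
theorem centered_bernoulli_mgf_le {p s t δ : ℝ} (hp0 : 0 ≤ p) (hp1 : p ≤ 1) (hs : 0 ≤ s)
    (h : s ≤ p * δ) (ht : |t| * δ ≤ 1) :
    p * Real.exp ((t * (1 / p - 1) - t ^ 2 * δ) * s) +
      (1 - p) * Real.exp ((-t - t ^ 2 * δ) * s) ≤ 1 := by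
  rcases hp0.eq_or_lt with rfl | hp
  · have : s = 0 := by linarith
    simp [this]
  have hsp : s / p ≤ δ := by rw [div_le_iff₀ hp]; linarith
  have hδ : 0 ≤ δ := (div_nonneg hs hp.le).trans hsp
  have hsp0 : 0 ≤ s / p := div_nonneg hs hp.le
  have hss : s ≤ s / p := by rw [le_div_iff₀ hp]; nlinarith
  have key : ∀ a : ℝ, |a| ≤ 1 → Real.exp a ≤ 1 + a + a ^ 2 := by
    intro a ha
    have := (abs_le.mp (Real.abs_exp_sub_one_sub_id_le ha)).2
    linarith
  have ha : |t * (1 / p - 1) * s| ≤ 1 := by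
    have h1 : (1 / p - 1) * s = s / p - s := by ring
    rw [mul_assoc, h1, abs_mul, abs_of_nonneg (show 0 ≤ s / p - s by linarith)]
    exact (mul_le_mul_of_nonneg_left (by linarith) (abs_nonneg t)).trans ht
  have hb : |-t * s| ≤ 1 := by
    rw [abs_mul, abs_neg, abs_of_nonneg hs]
    exact (mul_le_mul_of_nonneg_left (by linarith) (abs_nonneg t)).trans ht
  have h3 : p * Real.exp (t * (1 / p - 1) * s) + (1 - p) * Real.exp (-t * s) ≤
      Real.exp (t ^ 2 * δ * s) := by
    calc _ ≤ p * (1 + t * (1 / p - 1) * s + (t * (1 / p - 1) * s) ^ 2) +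
          (1 - p) * (1 + -t * s + (-t * s) ^ 2) :=
          add_le_add (mul_le_mul_of_nonneg_left (key _ ha) hp0)
            (mul_le_mul_of_nonneg_left (key _ hb) (by linarith))
      _ = 1 + t ^ 2 * s * ((s / p) * (1 - p)) := by field_simp; ring
      _ ≤ 1 + t ^ 2 * s * (δ * 1) := by
          gcongr
          linarith
      _ ≤ _ := by
          have := Real.add_one_le_exp (t ^ 2 * δ * s)
          linarith
  have h4 : ∀ a : ℝ, Real.exp ((a - t ^ 2 * δ) * s) =
      Real.exp (a * s) * Real.exp (-(t ^ 2 * δ * s)) := by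
    intro a
    rw [← Real.exp_add]; congr 1; ring
  rw [h4, h4, ← mul_assoc, ← mul_assoc, ← add_mul]
  calc _ ≤ Real.exp (t ^ 2 * δ * s) * Real.exp (-(t ^ 2 * δ * s)) :=
        mul_le_mul_of_nonneg_right h3 (Real.exp_pos _).le
    _ = 1 := by rw [← Real.exp_add]; simp

theorem dotProduct_sum_vecMulVec_mulVec (S : Finset (Fin n)) (z : Fin n → ℝ)
    (v : Fin n → Fin d → ℝ) (y : Fin d → ℝ) :
    y ⬝ᵥ ((∑ i ∈ S, z i • Matrix.vecMulVec (v i) (v i)) *ᵥ y) =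
      ∑ i ∈ S, z i * (v i ⬝ᵥ y) ^ 2 := by
  rw [Matrix.sum_mulVec, dotProduct_sum]
  refine Finset.sum_congr rfl fun i _ => ?_
  rw [Matrix.smul_mulVec, Matrix.vecMulVec_mulVec, dotProduct_smul]
  simp only [op_smul_eq_smul, dotProduct_smul, smul_eq_mul]
  rw [dotProduct_comm y]; ring

/-- One-sided bound, with the sign of t choosing the side. The compensators are added back as the
starting matrix D, which is at most t² δ times the identity, so D costs only a factor exp(t² δ). -/
theorem bernoulliProb_deviation_le_aux (S : Finset (Fin n)) {p : Fin n → ℝ}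
    (hp0 : ∀ i, 0 ≤ p i) (hp1 : ∀ i, p i ≤ 1) (v : Fin n → Fin d → ℝ)
    (hv : ∀ y, ∑ i ∈ S, (v i ⬝ᵥ y) ^ 2 ≤ y ⬝ᵥ y) {δ t ε : ℝ} (hδ : 0 < δ)
    (h : ∀ i ∈ S, p i = 1 ∨ v i ⬝ᵥ v i ≤ p i * δ) (ht : |t| * δ = ε / 2) (hε : ε ≤ 1) :
    bernoulliProb S p (fun T => ∃ y : Fin d → ℝ, |t| * ε * (y ⬝ᵥ y) <
      t * (∑ i ∈ T, (v i ⬝ᵥ y) ^ 2 / p i - ∑ i ∈ S, (v i ⬝ᵥ y) ^ 2)) ≤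
      d * Real.exp (-(ε ^ 2 / (4 * δ))) := by
  classical
  -- Rows with p i = 1 are deterministic, contribute no deviation and need no compensator; no norm
  -- bound is assumed for them.
  set g : Fin n → ℝ := fun i => if p i = 1 then 0 else t ^ 2 * δ with hg
  have hg0 : ∀ i, 0 ≤ g i ∧ g i ≤ t ^ 2 * δ := by
    intro i
    have : 0 ≤ t ^ 2 * δ := by positivity
    rw [hg]; dsimp only
    split_ifs
    · exact ⟨le_rfl, this⟩
    · exact ⟨this, le_rfl⟩
  set x : Fin n → ℝ := fun i => t * (1 / p i - 1) - g i with hx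
  set w : Fin n → ℝ := fun i => -t - g i with hw
  set D : Matrix (Fin d) (Fin d) ℝ := ∑ i ∈ S, g i • Matrix.vecMulVec (v i) (v i) with hD
  have hsymm : ∀ z : Fin n → ℝ, (∑ i ∈ S, z i • Matrix.vecMulVec (v i) (v i))ᵀ =
      ∑ i ∈ S, z i • Matrix.vecMulVec (v i) (v i) := by
    intro z
    rw [Matrix.transpose_sum]
    exact Finset.sum_congr rfl fun i _ => by
      rw [Matrix.transpose_smul, Matrix.transpose_vecMulVec]
  have hmgf : ∀ i ∈ S, p i * Real.exp (x i * (v i ⬝ᵥ v i)) +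
      (1 - p i) * Real.exp (w i * (v i ⬝ᵥ v i)) ≤ 1 := by
    intro i hi
    by_cases hpi : p i = 1
    · simp [hx, hg, hpi]
    · have h1 := centered_bernoulli_mgf_le (t := t) (hp0 i) (hp1 i)
        (show 0 ≤ v i ⬝ᵥ v i from Finset.sum_nonneg fun j _ => mul_self_nonneg (v i j))
        ((h i hi).resolve_left hpi) (by linarith)
      simpa only [hx, hw, hg, if_neg hpi] using h1
  have hmean := bernoulliMean_trace_exp_le S hp0 hp1 v x w hmgf D (hsymm g)
  have hDle : (exp D).trace ≤ d * Real.exp (t ^ 2 * δ) := by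
    have := trace_exp_le_card_mul D (hsymm g) (a := t ^ 2 * δ) fun y => by
      rw [hD, dotProduct_sum_vecMulVec_mulVec]
      calc _ ≤ ∑ i ∈ S, t ^ 2 * δ * (v i ⬝ᵥ y) ^ 2 :=
            Finset.sum_le_sum fun i _ => mul_le_mul_of_nonneg_right (hg0 i).2 (sq_nonneg _)
        _ ≤ _ := by
            rw [← Finset.mul_sum]
            exact mul_le_mul_of_nonneg_left (hv y) (by positivity)
    simpa using this
  -- The absolute value only supplies nonnegativity for every T; it is removed below, as the trace
  -- is positive.
  have hE := bernoulliProb_le_mean hp0 hp1 (S := S)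
    (E := fun T => ∃ y : Fin d → ℝ, |t| * ε * (y ⬝ᵥ y) <
      t * (∑ i ∈ T, (v i ⬝ᵥ y) ^ 2 / p i - ∑ i ∈ S, (v i ⬝ᵥ y) ^ 2))
    (f := fun T => Real.exp (-(|t| * ε)) * |(exp (D + ∑ i ∈ S, (if i ∈ T then x i else w i) •
      Matrix.vecMulVec (v i) (v i))).trace|) (fun T => by positivity) (by
      rintro T hT ⟨y, hy⟩
      have hsum : D + ∑ i ∈ S, (if i ∈ T then x i else w i) • Matrix.vecMulVec (v i) (v i) =
          ∑ i ∈ S, (g i + if i ∈ T then x i else w i) • Matrix.vecMulVec (v i) (v i) := by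
        rw [hD, ← Finset.sum_add_distrib]
        exact Finset.sum_congr rfl fun i _ => (add_smul _ _ _).symm
      have hlow : Real.exp (|t| * ε) ≤ (exp (D + ∑ i ∈ S, (if i ∈ T then x i else w i) •
          Matrix.vecMulVec (v i) (v i))).trace := by
        rw [hsum]
        refine exp_le_trace_exp _ (hsymm _) y (hy.trans_eq ?_)
        rw [dotProduct_sum_vecMulVec_mulVec, ← Finset.inter_eq_right.mpr hT,
          ← Finset.sum_ite_mem, ← Finset.sum_sub_distrib, Finset.mul_sum]
        refine Finset.sum_congr rfl fun i _ => ?_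
        by_cases hi : i ∈ T
        · have hi' : i ∈ S ∩ T := Finset.mem_inter.mpr ⟨hT hi, hi⟩
          simp only [hi, hi', if_true, hx]; ring
        · have hi' : i ∉ S ∩ T := fun hh => hi (Finset.mem_inter.mp hh).2
          simp only [hi, hi', if_false, hw]; ring
      calc (1 : ℝ) = Real.exp (-(|t| * ε)) * Real.exp (|t| * ε) := by
            rw [← Real.exp_add]; simp
        _ ≤ _ := by
            gcongr
            exact hlow.trans (le_abs_self _))
  refine hE.trans ?_
  rw [bernoulliMean_const_mul]
  have hpos : ∀ T : Finset (Fin n), 0 ≤ (exp (D + ∑ i ∈ S, (if i ∈ T then x i else w i) •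
      Matrix.vecMulVec (v i) (v i))).trace := by
    intro T
    have hs : (D + ∑ i ∈ S, (if i ∈ T then x i else w i) • Matrix.vecMulVec (v i) (v i))ᵀ =
        D + ∑ i ∈ S, (if i ∈ T then x i else w i) • Matrix.vecMulVec (v i) (v i) := by
      rw [Matrix.transpose_add, hsymm, hsymm]
    obtain ⟨U, e, h1, h2, h3⟩ := exists_spectral _ hs
    rw [h3, trace_exp_of_spectral h1 h2]
    exact Finset.sum_nonneg fun k _ => (Real.exp_pos _).le
  simp only [abs_of_nonneg (hpos _)]
  calc _ ≤ Real.exp (-(|t| * ε)) * (d * Real.exp (t ^ 2 * δ)) :=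
        mul_le_mul_of_nonneg_left (hmean.trans hDle) (Real.exp_pos _).le
    _ = d * Real.exp (-(ε ^ 2 / (4 * δ))) := by
        rw [mul_left_comm, ← Real.exp_add]
        congr 2
        -- This t minimizes t² δ − |t| ε, with value −ε² / (4δ).
        have ht' : |t| = ε / (2 * δ) := by field_simp; linarith
        rw [← sq_abs, ht']; field_simp; ring

/-- A matrix Chernoff bound for independently sampled and rescaled rows. -/
theorem bernoulliProb_deviation_le (S : Finset (Fin n)) {p : Fin n → ℝ}
    (hp0 : ∀ i, 0 ≤ p i) (hp1 : ∀ i, p i ≤ 1) (v : Fin n → Fin d → ℝ)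
    (hv : ∀ y, ∑ i ∈ S, (v i ⬝ᵥ y) ^ 2 ≤ y ⬝ᵥ y) {δ ε : ℝ} (hδ : 0 < δ)
    (h : ∀ i ∈ S, p i = 1 ∨ v i ⬝ᵥ v i ≤ p i * δ) (hε0 : 0 < ε) (hε : ε ≤ 1) :
    bernoulliProb S p (fun T => ∃ y : Fin d → ℝ, ε * (y ⬝ᵥ y) <
      |∑ i ∈ T, (v i ⬝ᵥ y) ^ 2 / p i - ∑ i ∈ S, (v i ⬝ᵥ y) ^ 2|) ≤
      2 * d * Real.exp (-(ε ^ 2 / (4 * δ))) := by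
  have ht0 : 0 < ε / (2 * δ) := by positivity
  have h1 := bernoulliProb_deviation_le_aux S hp0 hp1 v hv (t := ε / (2 * δ)) hδ h
    (by rw [abs_of_pos ht0]; field_simp) hε
  have h2 := bernoulliProb_deviation_le_aux S hp0 hp1 v hv (t := -(ε / (2 * δ))) hδ h
    (by rw [abs_neg, abs_of_pos ht0]; field_simp) hε
  rw [abs_neg] at h2
  rw [abs_of_pos ht0] at h1 h2
  have h3 := bernoulliProb_or_le hp0 hp1 (S := S)
    (fun T => ∃ y : Fin d → ℝ, ε / (2 * δ) * ε * (y ⬝ᵥ y) <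
      ε / (2 * δ) * (∑ i ∈ T, (v i ⬝ᵥ y) ^ 2 / p i - ∑ i ∈ S, (v i ⬝ᵥ y) ^ 2))
    (fun T => ∃ y : Fin d → ℝ, ε / (2 * δ) * ε * (y ⬝ᵥ y) <
      -(ε / (2 * δ)) * (∑ i ∈ T, (v i ⬝ᵥ y) ^ 2 / p i - ∑ i ∈ S, (v i ⬝ᵥ y) ^ 2))
  refine (bernoulliProb_mono hp0 hp1 ?_).trans (h3.trans (by linarith))
  rintro T - ⟨y, hy⟩
  rcases lt_abs.mp hy with hy | hy
  · refine Or.inl ⟨y, ?_⟩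
    rw [mul_assoc]
    exact mul_lt_mul_of_pos_left hy ht0
  · refine Or.inr ⟨y, ?_⟩
    rw [mul_assoc, neg_mul_comm]
    exact mul_lt_mul_of_pos_left hy ht0

end MatrixConcentration

end BernoulliMean

/-! ### Quadratic forms, whitening and leverage scores -/

section Whitening

variable {n d : ℕ}

/-- The quadratic form `‖A_S x‖²` of the rows of `A` in `S`. -/
def rowForm (A : Matrix (Fin n) (Fin d) ℝ) (S : Finset (Fin n)) (x : Fin d → ℝ) : ℝ :=
  ∑ i ∈ S, (A i ⬝ᵥ x) ^ 2

theorem rowForm_nonneg (A : Matrix (Fin n) (Fin d) ℝ) (S : Finset (Fin n)) (x : Fin d → ℝ) :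
    0 ≤ rowForm A S x := Finset.sum_nonneg fun _ _ => sq_nonneg _

theorem rowForm_mono (A : Matrix (Fin n) (Fin d) ℝ) {S T : Finset (Fin n)} (h : S ⊆ T)
    (x : Fin d → ℝ) : rowForm A S x ≤ rowForm A T x :=
  Finset.sum_le_sum_of_subset_of_nonneg h fun _ _ _ => sq_nonneg _

/-- The quadratic form `‖B x‖²` of the matrix `B` of sampled and rescaled rows of `A`. -/
def RowSample.form (X : RowSample n) (A : Matrix (Fin n) (Fin d) ℝ) (x : Fin d → ℝ) : ℝ :=
  ∑ i ∈ X.rows, (X.scale i * (A i ⬝ᵥ x)) ^ 2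

theorem RowSample.toMatrix_mulVec (X : RowSample n) (A : Matrix (Fin n) (Fin d) ℝ)
    (x : Fin d → ℝ) (i : X.rows) : (X.toMatrix A *ᵥ x) i = X.scale i * (A i ⬝ᵥ x) := by
  simp only [Matrix.mulVec, dotProduct, RowSample.toMatrix, Finset.mul_sum, mul_assoc]

theorem RowSample.form_eq (X : RowSample n) (A : Matrix (Fin n) (Fin d) ℝ) (x : Fin d → ℝ) :
    (X.toMatrix A *ᵥ x) ⬝ᵥ (X.toMatrix A *ᵥ x) = X.form A x := by
  rw [dotProduct, RowSample.form,
    ← Finset.sum_coe_sort X.rows fun i => (X.scale i * (A i ⬝ᵥ x)) ^ 2]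
  exact Finset.sum_congr rfl fun i _ => by rw [X.toMatrix_mulVec, sq]

/-- With AₛᵀAₛ = U diag(e) Uᵀ, take R = diag(√e) Uᵀ and v i = diag(e)^(-1/2) Uᵀ aᵢ. Coordinates with
e k = 0 vanish for all rows of S, so division by zero is harmless. Then Σ vᵢvᵢᵀ is a projection of
rank at most d, and |vᵢ|² is the leverage score. Membership in the range of R lets vᵢ serve as a
test vector. -/
theorem exists_whitening (A : Matrix (Fin n) (Fin d) ℝ) (S : Finset (Fin n)) :
    ∃ (R : Matrix (Fin d) (Fin d) ℝ) (v : Fin n → Fin d → ℝ),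
      (∀ i ∈ S, ∀ x, A i ⬝ᵥ x = v i ⬝ᵥ (R *ᵥ x)) ∧
      (∀ x, (R *ᵥ x) ⬝ᵥ (R *ᵥ x) = rowForm A S x) ∧
      (∀ y, ∑ i ∈ S, (v i ⬝ᵥ y) ^ 2 ≤ y ⬝ᵥ y) ∧
      ∑ i ∈ S, v i ⬝ᵥ v i ≤ d ∧
      ∀ i ∈ S, ∃ x, v i = R *ᵥ x := by
  have hform : ∀ (c : Fin n → Fin d → ℝ) (y : Fin d → ℝ),
      y ⬝ᵥ ((∑ i ∈ S, Matrix.vecMulVec (c i) (c i)) *ᵥ y) = ∑ i ∈ S, (c i ⬝ᵥ y) ^ 2 := by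
    intro c y
    simpa using dotProduct_sum_vecMulVec_mulVec S (fun _ => 1) c y
  have hsymm : (∑ i ∈ S, Matrix.vecMulVec (A i) (A i))ᵀ =
      ∑ i ∈ S, Matrix.vecMulVec (A i) (A i) := by
    rw [Matrix.transpose_sum]
    exact Finset.sum_congr rfl fun i _ => Matrix.transpose_vecMulVec _ _
  obtain ⟨U, e, h1, h2, hG⟩ := exists_spectral _ hsymm
  set c : Fin n → Fin d → ℝ := fun i => Uᵀ *ᵥ A i with hc
  have hcc : ∑ i ∈ S, Matrix.vecMulVec (c i) (c i) = Matrix.diagonal e := by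
    have h3 : ∀ i, Matrix.vecMulVec (c i) (c i) = Uᵀ * Matrix.vecMulVec (A i) (A i) * U := by
      intro i
      rw [Matrix.mul_vecMulVec, Matrix.vecMulVec_mul, hc, ← Matrix.mulVec_transpose]
    simp only [h3]
    rw [← Finset.sum_mul, ← Finset.mul_sum, hG]
    calc _ = (Uᵀ * U) * Matrix.diagonal e * (Uᵀ * U) := by simp only [Matrix.mul_assoc]
      _ = _ := by rw [h1, Matrix.one_mul, Matrix.mul_one]
  have hdiag : ∀ k, ∑ i ∈ S, c i k ^ 2 = e k := by
    intro k
    have := congrFun (congrFun hcc k) k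
    rw [Matrix.sum_apply, Matrix.diagonal_apply_eq] at this
    simpa [Matrix.vecMulVec_apply, sq] using this
  have he : ∀ k, 0 ≤ e k := fun k => hdiag k ▸ Finset.sum_nonneg fun _ _ => sq_nonneg _
  have hc0 : ∀ i ∈ S, ∀ k, e k = 0 → c i k = 0 := by
    intro i hi k hk
    have h3 := (Finset.sum_eq_zero_iff_of_nonneg fun _ _ => sq_nonneg _).mp ((hdiag k).trans hk) i hi
    exact pow_eq_zero_iff two_ne_zero |>.mp h3
  have hR : ∀ x k, ((Matrix.diagonal (fun k => Real.sqrt (e k)) * Uᵀ) *ᵥ x) k =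
      Real.sqrt (e k) * (Uᵀ *ᵥ x) k := by
    intro x k
    rw [← Matrix.mulVec_mulVec, Matrix.mulVec_diagonal]
  refine ⟨Matrix.diagonal (fun k => Real.sqrt (e k)) * Uᵀ, fun i k => c i k / Real.sqrt (e k),
    ?_, ?_, ?_, ?_, ?_⟩
  · intro i hi x
    have h3 : A i ⬝ᵥ x = c i ⬝ᵥ (Uᵀ *ᵥ x) := by
      rw [hc, Matrix.dotProduct_mulVec, ← Matrix.mulVec_transpose, Matrix.transpose_transpose,
        Matrix.mulVec_mulVec, h2, Matrix.one_mulVec]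
    rw [h3]
    refine Finset.sum_congr rfl fun k _ => ?_
    rw [hR]
    rcases eq_or_ne (e k) 0 with hk | hk
    · simp [hc0 i hi k hk]
    · have : Real.sqrt (e k) ≠ 0 := (Real.sqrt_pos.mpr ((he k).lt_of_ne' hk)).ne'
      field_simp
  · intro x
    refine Eq.trans ?_ (hform A x)
    rw [hG, dotProduct_spectral_mulVec, dotProduct]
    refine Finset.sum_congr rfl fun k _ => ?_
    rw [hR]
    linear_combination (Uᵀ *ᵥ x) k ^ 2 * Real.mul_self_sqrt (he k)
  · intro y
    have h3 := hform c (fun k => y k / Real.sqrt (e k))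
    have h4 : ∀ i, (fun k => c i k / Real.sqrt (e k)) ⬝ᵥ y =
        c i ⬝ᵥ fun k => y k / Real.sqrt (e k) := fun i =>
      Finset.sum_congr rfl fun k _ => by ring
    simp only [h4]
    rw [← h3, hcc, dotProduct, dotProduct]
    refine Finset.sum_le_sum fun k _ => ?_
    rw [Matrix.mulVec_diagonal]
    rcases eq_or_ne (e k) 0 with hk | hk
    · simp [hk, mul_self_nonneg]
    · have h5 := Real.mul_self_sqrt (he k)
      have : Real.sqrt (e k) ≠ 0 := (Real.sqrt_pos.mpr ((he k).lt_of_ne' hk)).ne'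
      apply le_of_eq
      nth_rewrite 2 [← h5]
      field_simp
  · simp only [dotProduct]
    rw [Finset.sum_comm]
    calc _ ≤ ∑ _k : Fin d, (1 : ℝ) := by
          refine Finset.sum_le_sum fun k _ => ?_
          have h5 : ∀ i, c i k / Real.sqrt (e k) * (c i k / Real.sqrt (e k)) =
              c i k ^ 2 / e k := by
            intro i
            rw [div_mul_div_comm, Real.mul_self_sqrt (he k), sq]
          simp only [h5]
          rw [← Finset.sum_div, hdiag]
          exact div_self_le_one _
      _ = d := by simp
  · intro i hi
    refine ⟨U *ᵥ fun k => c i k / e k, ?_⟩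
    funext k
    rw [hR, Matrix.mulVec_mulVec, h1, Matrix.one_mulVec]
    rcases eq_or_ne (e k) 0 with hk | hk
    · simp [hk]
    · have h5 := Real.mul_self_sqrt (he k)
      have : Real.sqrt (e k) ≠ 0 := (Real.sqrt_pos.mpr ((he k).lt_of_ne' hk)).ne'
      change c i k / Real.sqrt (e k) = Real.sqrt (e k) * (c i k / e k)
      rw [div_eq_iff this, mul_right_comm, h5]
      field_simp

theorem dotProduct_sq_le (v w : Fin d → ℝ) : (v ⬝ᵥ w) ^ 2 ≤ (v ⬝ᵥ v) * (w ⬝ᵥ w) := by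
  have := Finset.sum_mul_sq_le_sq_mul_sq Finset.univ v w
  simpa only [dotProduct, sq] using this

/-- A whitened row has squared norm at most `β` when `(aᵢ x)² ≤ β ‖A_S x‖²` for all `x`. -/
theorem whitened_norm_le {A : Matrix (Fin n) (Fin d) ℝ} {S : Finset (Fin n)}
    {R : Matrix (Fin d) (Fin d) ℝ} {v : Fin d → ℝ} {i : Fin n} {β : ℝ}
    (h1 : ∀ x, A i ⬝ᵥ x = v ⬝ᵥ (R *ᵥ x)) (h2 : ∀ x, (R *ᵥ x) ⬝ᵥ (R *ᵥ x) = rowForm A S x)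
    (h3 : ∃ x, v = R *ᵥ x) (hβ : ∀ x, (A i ⬝ᵥ x) ^ 2 ≤ β * rowForm A S x) (hβ0 : 0 ≤ β) :
    v ⬝ᵥ v ≤ β := by
  obtain ⟨x, hx⟩ := h3
  have h4 := hβ x
  rw [h1, ← h2, ← hx, sq] at h4
  rcases (show 0 ≤ v ⬝ᵥ v from Finset.sum_nonneg fun j _ => mul_self_nonneg (v j)).eq_or_lt
    with h | h
  · rw [← h]; exact hβ0
  · exact le_of_mul_le_mul_right h4 h

variable {m : Type*} [Fintype m]

theorem dotProduct_gram_mulVec (B : Matrix m (Fin d) ℝ) (x y : Fin d → ℝ) :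
    x ⬝ᵥ ((Bᵀ * B) *ᵥ y) = (B *ᵥ x) ⬝ᵥ (B *ᵥ y) := by
  rw [← Matrix.mulVec_mulVec, Matrix.dotProduct_mulVec, Matrix.vecMul_transpose]

theorem pinv_transpose (G : Matrix (Fin d) (Fin d) ℝ) (hG : G.IsHermitian) :
    (pinv G hG)ᵀ = pinv G hG := by
  simp [pinv, Matrix.transpose_mul, Matrix.mul_assoc]

/-- x − G†Gx lies in ker B, where a vanishes, so x may be replaced by G†Gx. -/
theorem pinv_reproducing (B : Matrix m (Fin d) ℝ) (a : Fin d → ℝ)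
    (ha : ∀ x : Fin d → ℝ, B *ᵥ x = 0 → a ⬝ᵥ x = 0) (x : Fin d → ℝ) :
    a ⬝ᵥ x = (B *ᵥ (pinv (Bᵀ * B) (gram_isHermitian B) *ᵥ a)) ⬝ᵥ (B *ᵥ x) := by
  have hX := pinv_isMoorePenrose (Bᵀ * B) (gram_isHermitian B)
  have hXt := pinv_transpose (Bᵀ * B) (gram_isHermitian B)
  have hGXG := hX.mul_mul_self
  generalize pinv (Bᵀ * B) (gram_isHermitian B) = X at hGXG hXt
  obtain ⟨G, hG⟩ : ∃ G, G = Bᵀ * B := ⟨_, rfl⟩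
  rw [← hG] at hGXG
  have hker : B *ᵥ (x - X *ᵥ (G *ᵥ x)) = 0 := by
    have h1 : G *ᵥ (x - X *ᵥ (G *ᵥ x)) = 0 := by
      rw [Matrix.mulVec_sub, Matrix.mulVec_mulVec, Matrix.mulVec_mulVec, hGXG, sub_self]
    rw [← dotProduct_self_eq_zero, ← dotProduct_gram_mulVec, ← hG, h1, dotProduct_zero]
  have h2 := ha _ hker
  rw [dotProduct_sub, sub_eq_zero] at h2
  rw [h2, ← dotProduct_gram_mulVec, ← hG, Matrix.dotProduct_mulVec, ← Matrix.mulVec_transpose, hXt]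

theorem pinv_quadratic (B : Matrix m (Fin d) ℝ) (a : Fin d → ℝ) :
    a ⬝ᵥ (pinv (Bᵀ * B) (gram_isHermitian B) *ᵥ a) =
      (B *ᵥ (pinv (Bᵀ * B) (gram_isHermitian B) *ᵥ a)) ⬝ᵥ
        (B *ᵥ (pinv (Bᵀ * B) (gram_isHermitian B) *ᵥ a)) := by
  have hX := pinv_isMoorePenrose (Bᵀ * B) (gram_isHermitian B)
  have hXt := pinv_transpose (Bᵀ * B) (gram_isHermitian B)
  rw [← dotProduct_gram_mulVec]
  set X := pinv (Bᵀ * B) (gram_isHermitian B)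
  calc a ⬝ᵥ (X *ᵥ a) = a ⬝ᵥ ((X * (Bᵀ * B) * X) *ᵥ a) := by rw [hX.self_mul_mul]
    _ = _ := by
      rw [Matrix.mul_assoc X, ← Matrix.mulVec_mulVec, Matrix.dotProduct_mulVec,
        ← Matrix.mulVec_transpose, hXt, ← Matrix.mulVec_mulVec]

/-- Testing x = G†a gives the bound. Together with `dotProduct_sq_le_genLeverage` this identifies
the score as the least β with (a·x)² ≤ β ‖Bx‖², the only property used later. -/
theorem genLeverage_le {B : Matrix m (Fin d) ℝ} {a : Fin d → ℝ} {β : ℝ} (hβ : 0 ≤ β)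
    (h : ∀ x, (a ⬝ᵥ x) ^ 2 ≤ β * ((B *ᵥ x) ⬝ᵥ (B *ᵥ x))) :
    genLeverage B a ≤ ENNReal.ofReal β := by
  have hker : ∀ x : Fin d → ℝ, B *ᵥ x = 0 → a ⬝ᵥ x = 0 := by
    intro x hx
    have h1 := h x
    rw [hx, zero_dotProduct, mul_zero] at h1
    exact pow_eq_zero_iff two_ne_zero |>.mp (le_antisymm h1 (sq_nonneg _))
  rw [genLeverage, if_pos hker]
  refine ENNReal.ofReal_le_ofReal ?_
  have h1 := h (pinv (Bᵀ * B) (gram_isHermitian B) *ᵥ a)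
  rw [← pinv_quadratic, sq] at h1
  rcases lt_or_ge 0 (a ⬝ᵥ (pinv (Bᵀ * B) (gram_isHermitian B) *ᵥ a)) with h2 | h2
  · exact le_of_mul_le_mul_right h1 h2
  · exact h2.trans hβ

theorem dotProduct_sq_le_genLeverage {B : Matrix m (Fin d) ℝ} {a : Fin d → ℝ}
    (h : genLeverage B a ≠ ⊤) (x : Fin d → ℝ) :
    (a ⬝ᵥ x) ^ 2 ≤ (genLeverage B a).toReal * ((B *ᵥ x) ⬝ᵥ (B *ᵥ x)) := by
  rw [genLeverage] at h ⊢
  split_ifs at h ⊢ with hker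
  · rw [ENNReal.toReal_ofReal (by
      rw [pinv_quadratic]; exact Finset.sum_nonneg fun _ _ => mul_self_nonneg _),
      pinv_quadratic, pinv_reproducing B a hker x]
    have := Finset.sum_mul_sq_le_sq_mul_sq Finset.univ
      (B *ᵥ (pinv (Bᵀ * B) (gram_isHermitian B) *ᵥ a)) (B *ᵥ x)
    simpa only [dotProduct, sq] using this
  · exact absurd rfl h

end Whitening

/-! ### Uniform halving -/

section UniformHalving

variable {n d : ℕ}

/-- Up to at most `r` rows of `S`, the rows in `T` spectrally dominate those in `S`. -/
def Dominates (A : Matrix (Fin n) (Fin d) ℝ) (r : ℕ) (S T : Finset (Fin n)) : Prop :=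
  ∃ V ⊆ S, (S \ V).card ≤ r ∧ ∀ x, rowForm A V x ≤ 4 * rowForm A T x

/-- By Cauchy–Schwarz a heavy row has whitened squared norm at least α, and these norms sum to at
most d. -/
theorem card_mul_le_of_heavy (A : Matrix (Fin n) (Fin d) ℝ) {K W : Finset (Fin n)} {α : ℝ}
    (hKW : K ⊆ W) (h : ∀ i ∈ K, ∃ x, α * rowForm A W x < (A i ⬝ᵥ x) ^ 2) :
    K.card * α ≤ d := by
  obtain ⟨R, v, h1, h2, -, h4, -⟩ := exists_whitening A W
  have hnn : ∀ i, 0 ≤ v i ⬝ᵥ v i := fun i => Finset.sum_nonneg fun j _ => mul_self_nonneg _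
  refine le_trans ?_ ((Finset.sum_le_sum_of_subset_of_nonneg hKW fun i _ _ => hnn i).trans h4)
  rw [← nsmul_eq_mul]
  refine Finset.card_nsmul_le_sum _ _ _ fun i hi => ?_
  obtain ⟨x, hx⟩ := h i hi
  have h5 := dotProduct_sq_le (v i) (R *ᵥ x)
  rw [← h1 i (hKW hi), h2] at h5
  by_contra hlt
  have := mul_le_mul_of_nonneg_right (not_le.mp hlt).le (rowForm_nonneg A W x)
  linarith

/-- K is kept in full, so only the light rows of U are random, and they are whitened with respect to
K ∪ U. -/
theorem bernoulliProb_not_dominated_of_light (A : Matrix (Fin n) (Fin d) ℝ)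
    {K U : Finset (Fin n)} {α : ℝ} (hα : 0 < α) (hKU : Disjoint K U)
    (h : ∀ i ∈ U, ∀ x, (A i ⬝ᵥ x) ^ 2 ≤ α * rowForm A (K ∪ U) x) :
    bernoulliProb U (fun _ => 1 / 2)
      (fun T => ¬ ∀ x, rowForm A (K ∪ U) x ≤ 4 * rowForm A (K ∪ T) x) ≤
      2 * d * Real.exp (-(1 / (32 * α))) := by
  obtain ⟨R, v, h1, h2, h3, -, h5⟩ := exists_whitening A (K ∪ U)
  have hU : ∀ i ∈ U, i ∈ K ∪ U := fun i hi => Finset.mem_union_right _ hi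
  have hp0 : ∀ i : Fin n, (0 : ℝ) ≤ (fun _ => 1 / 2) i := fun _ => by norm_num
  have hp1 : ∀ i : Fin n, (fun _ => (1 / 2 : ℝ)) i ≤ 1 := fun _ => by norm_num
  -- Rate 1/2 and squared norm at most α give δ = 2α; deviation 1/2 is enough for the factor 4.
  have key := bernoulliProb_deviation_le U hp0 hp1 v (fun y =>
    (Finset.sum_le_sum_of_subset_of_nonneg Finset.subset_union_right
      fun _ _ _ => sq_nonneg _).trans (h3 y)) (δ := 2 * α) (ε := 1 / 2) (by positivity)
    (fun i hi => Or.inr (by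
      have := whitened_norm_le (h1 i (hU i hi)) h2 (h5 i (hU i hi)) (h i hi) hα.le
      linarith)) (by norm_num) (by norm_num)
  refine (bernoulliProb_mono hp0 hp1 ?_).trans (key.trans_eq (by congr 3; field_simp; norm_num))
  intro T hT hfail
  push Not at hfail
  obtain ⟨x, hx⟩ := hfail
  refine ⟨R *ᵥ x, ?_⟩
  have hsum : ∀ Q ⊆ U, ∑ i ∈ Q, (v i ⬝ᵥ (R *ᵥ x)) ^ 2 = rowForm A Q x := fun Q hQ =>
    Finset.sum_congr rfl fun i hi => by rw [← h1 i (hU i (hQ hi))]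
  have hsplit : ∀ Q ⊆ U, rowForm A (K ∪ Q) x = rowForm A K x + rowForm A Q x := fun Q hQ =>
    Finset.sum_union (Finset.disjoint_of_subset_right hQ hKU)
  rw [h2, ← Finset.sum_div, hsum T hT, hsum U subset_rfl]
  rw [hsplit T hT] at hx
  have hK := rowForm_nonneg A K x
  have hUU := hsplit U subset_rfl
  refine lt_of_lt_of_le ?_ (neg_le_abs _)
  linarith

/-- K holds the revealed rows that were kept, U the unrevealed ones, and r the remaining budget of
rejected rows. As long as U has a heavy row, its coin is revealed. Rejection only shrinks K ∪ U, so
rows of K stay heavy and number at most k₀. The last term of the bound is a martingale potential. -/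
theorem bernoulliProb_not_dominates_aux (A : Matrix (Fin n) (Fin d) ℝ) {α : ℝ} (hα : 0 < α)
    {k₀ : ℕ} (hk₀ : d ≤ α * k₀) (N : ℕ) (K U : Finset (Fin n)) (r : ℕ) (hN : U.card = N)
    (hKU : Disjoint K U)
    (hK : ∀ i ∈ K, ∃ x, α * rowForm A (K ∪ U) x < (A i ⬝ᵥ x) ^ 2) :
    bernoulliProb U (fun _ => 1 / 2) (fun T => ¬ ∃ V ⊆ K ∪ U, ((K ∪ U) \ V).card < r ∧
      ∀ x, rowForm A V x ≤ 4 * rowForm A (K ∪ T) x) ≤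
      2 * d * Real.exp (-(1 / (32 * α))) + 2 ^ k₀ * (1 / 2) ^ K.card * (2 / 3) ^ r := by
  have hp0 : ∀ i : Fin n, (0 : ℝ) ≤ (fun _ => 1 / 2) i := fun _ => by norm_num
  have hp1 : ∀ i : Fin n, (fun _ => (1 / 2 : ℝ)) i ≤ 1 := fun _ => by norm_num
  induction N generalizing K U r with
  | zero | succ N ih => ?_
  all_goals
    -- With no budget left the event is certain, but |K| ≤ k₀ makes the potential at least 1.
    rcases r with _ | r
    · refine (bernoulliProb_le_one hp0 hp1 _).trans ?_
      have hcard : K.card ≤ k₀ := by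
        have h1 := card_mul_le_of_heavy A Finset.subset_union_left hK
        have h2 : (K.card : ℝ) * α ≤ k₀ * α := by linarith
        exact_mod_cast le_of_mul_le_mul_right h2 hα
      have h1 : (1 : ℝ) ≤ 2 ^ k₀ * (1 / 2) ^ K.card * (2 / 3) ^ 0 := by
        rw [pow_zero, mul_one, one_div, inv_pow, ← div_eq_mul_inv, one_le_div (by positivity)]
        exact pow_le_pow_right₀ one_le_two hcard
      have h2 : 0 ≤ 2 * d * Real.exp (-(1 / (32 * α))) := by positivity
      linarith
    by_cases hheavy : ∃ i ∈ U, ∃ x, α * rowForm A (K ∪ U) x < (A i ⬝ᵥ x) ^ 2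
    swap
    · push Not at hheavy
      have h1 := bernoulliProb_not_dominated_of_light A hα hKU hheavy
      have h2 : (0 : ℝ) ≤ 2 ^ k₀ * (1 / 2) ^ K.card * (2 / 3) ^ (r + 1) := by positivity
      refine (bernoulliProb_mono hp0 hp1 ?_).trans (h1.trans (by linarith))
      intro T _ hfail hdom
      exact hfail ⟨K ∪ U, subset_rfl, by simp, hdom⟩
  · obtain ⟨i, hi, -⟩ := hheavy
    rw [Finset.card_eq_zero] at hN
    simp [hN] at hi
  · obtain ⟨i, hi, hix⟩ := hheavy
    obtain ⟨U', hiU', rfl⟩ : ∃ U', i ∉ U' ∧ insert i U' = U :=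
      ⟨U.erase i, Finset.notMem_erase i U, Finset.insert_erase hi⟩
    have hiK : i ∉ K := fun hiK => Finset.disjoint_left.mp hKU hiK hi
    have hKU' : Disjoint K U' := Finset.disjoint_of_subset_right (Finset.subset_insert i U') hKU
    have hN' : U'.card = N := by rw [Finset.card_insert_of_notMem hiU'] at hN; omega
    have hun : insert i K ∪ U' = K ∪ insert i U' := by
      rw [Finset.insert_union, Finset.union_insert]
    have hA := ih (insert i K) U' (r + 1) hN'
      (Finset.disjoint_insert_left.mpr ⟨hiU', hKU'⟩) (by
        intro j hj
        rw [hun]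
        rcases Finset.mem_insert.mp hj with rfl | hj
        · exact hix
        · exact hK j hj)
    have hB := ih K U' r hN' hKU' (by
      intro j hj
      obtain ⟨x, hx⟩ := hK j hj
      refine ⟨x, lt_of_le_of_lt (mul_le_mul_of_nonneg_left (rowForm_mono A ?_ x) hα.le) hx⟩
      exact Finset.union_subset_union_right (Finset.subset_insert i U'))
    have hKT : ∀ T, insert i K ∪ T = K ∪ insert i T := fun T => by
      rw [Finset.insert_union, Finset.union_insert]
    simp only [hKT, Finset.card_insert_of_notMem hiK] at hA
    rw [bernoulliProb_insert hiU']
    -- Keeping the row multiplies the potential by 1/2, rejecting it by 3/2; the average is 1.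
    have hψ : (2 : ℝ) ^ k₀ * (1 / 2) ^ K.card * (2 / 3) ^ (r + 1) =
        1 / 2 * (2 ^ k₀ * (1 / 2) ^ (K.card + 1) * (2 / 3) ^ (r + 1)) +
        (1 - 1 / 2) * (2 ^ k₀ * (1 / 2) ^ K.card * (2 / 3) ^ r) := by ring
    refine (add_le_add (mul_le_mul_of_nonneg_left hA (hp0 i)) (mul_le_mul_of_nonneg_left
      ((bernoulliProb_mono hp0 hp1 ?_).trans hB) (sub_nonneg.mpr (hp1 i)))).trans ?_
    -- The rejected row joins the exceptional set and uses one unit of budget.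
    · rintro T - hfail ⟨V, hV, hVc, hVx⟩
      refine hfail ⟨V, hV.trans (Finset.union_subset_union_right (Finset.subset_insert i U')),
        ?_, hVx⟩
      have hsub : (K ∪ insert i U') \ V ⊆ insert i ((K ∪ U') \ V) := by
        rw [Finset.union_insert]
        intro j hj
        simp only [Finset.mem_sdiff, Finset.mem_insert] at hj ⊢
        tauto
      exact lt_of_le_of_lt ((Finset.card_le_card hsub).trans (Finset.card_insert_le _ _))
        (Nat.succ_lt_succ hVc)
    · rw [hψ]
      linarith

/-- Uniform sampling at rate `1/2` spectrally dominates all but a few rows. The rows of large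
leverage are revealed one at a time, and few of them can be kept. -/
theorem bernoulliProb_not_dominates_le (A : Matrix (Fin n) (Fin d) ℝ) (S : Finset (Fin n))
    {α : ℝ} (hα : 0 < α) {k₀ : ℕ} (hk₀ : d ≤ α * k₀) :
    bernoulliProb S (fun _ => 1 / 2) (fun T => ¬ Dominates A (4 * k₀) S T) ≤
      2 * d * Real.exp (-(1 / (32 * α))) + Real.exp (-(k₀ / 2)) := by
  have hp0 : ∀ i : Fin n, (0 : ℝ) ≤ (fun _ => 1 / 2) i := fun _ => by norm_num
  have hp1 : ∀ i : Fin n, (fun _ => (1 / 2 : ℝ)) i ≤ 1 := fun _ => by norm_num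
  have h1 := bernoulliProb_not_dominates_aux A hα hk₀ S.card ∅ S (4 * k₀) rfl
    (Finset.disjoint_empty_left S) (by simp)
  simp only [Finset.empty_union, Finset.card_empty, pow_zero, mul_one] at h1
  -- A budget of 4 k₀ beats the factor 2^k₀, since 2 (2/3)⁴ = 32/81 < exp(−1/2).
  have h2 : (2 : ℝ) ^ k₀ * (2 / 3) ^ (4 * k₀) ≤ Real.exp (-(k₀ / 2)) := by
    have h3 : (32 / 81 : ℝ) ≤ Real.exp (-(1 / 2)) := by
      have := Real.add_one_le_exp (-(1 / 2) : ℝ)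
      linarith
    calc (2 : ℝ) ^ k₀ * (2 / 3) ^ (4 * k₀) = (32 / 81) ^ k₀ := by
          rw [pow_mul, ← mul_pow]; norm_num
      _ ≤ Real.exp (-(1 / 2)) ^ k₀ := by gcongr
      _ = _ := by rw [← Real.exp_nat_mul]; congr 1; ring
  refine (bernoulliProb_mono hp0 hp1 ?_).trans (h1.trans (by linarith))
  rintro T - hfail ⟨V, hV, hVc, hVx⟩
  exact hfail ⟨V, hV, hVc.le, hVx⟩

end UniformHalving

/-! ### One round of weighted sampling -/

section WeightedRound

variable {n d : ℕ}

theorem sampleProb_le_one (c ε : ℝ) (d : ℕ) (w : ℝ≥0∞) : sampleProb c ε d w ≤ 1 :=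
  min_le_left _ _

theorem toReal_sampleProb_le_one (c ε : ℝ) (d : ℕ) (w : ℝ≥0∞) :
    (sampleProb c ε d w).toReal ≤ 1 :=
  ENNReal.toReal_le_of_le_ofReal zero_le_one (by simpa using sampleProb_le_one c ε d w)

theorem toReal_sampleProb_le {c ε β : ℝ} {d : ℕ} {w : ℝ≥0∞} (hθ : 0 ≤ c * Real.log d / ε ^ 2)
    (hβ : 0 ≤ β) (hw : w ≤ ENNReal.ofReal β) :
    (sampleProb c ε d w).toReal ≤ c * Real.log d / ε ^ 2 * β := by
  refine ENNReal.toReal_le_of_le_ofReal (mul_nonneg hθ hβ) ?_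
  rw [ENNReal.ofReal_mul hθ]
  exact (min_le_right _ _).trans (by gcongr)

theorem toReal_sampleProb_eq {c ε : ℝ} {d : ℕ} {w : ℝ≥0∞} (hθ : 0 < c * Real.log d / ε ^ 2) :
    (sampleProb c ε d w).toReal = 1 ∨
      w ≠ ⊤ ∧ (sampleProb c ε d w).toReal = c * Real.log d / ε ^ 2 * w.toReal := by
  rcases le_total 1 (ENNReal.ofReal (c * Real.log d / ε ^ 2) * w) with h | h
  · left; rw [sampleProb, min_eq_left h, ENNReal.toReal_one]
  · right
    refine ⟨?_, ?_⟩
    · rintro rfl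
      rw [ENNReal.mul_top (ENNReal.ofReal_pos.mpr hθ).ne'] at h
      exact absurd h (by simp)
    · rw [sampleProb, min_eq_right h, ENNReal.toReal_mul, ENNReal.toReal_ofReal hθ.le]

/-- `B` has the quadratic form of the rows of `A` in `S`, up to a factor `1 ± δ`. -/
def RowSample.Approximates (B : RowSample n) (A : Matrix (Fin n) (Fin d) ℝ) (δ : ℝ)
    (S : Finset (Fin n)) : Prop :=
  ∀ x, |B.form A x - rowForm A S x| ≤ δ * rowForm A S x

theorem form_of_weights (A : Matrix (Fin n) (Fin d) ℝ) (T : Finset (Fin n)) {p : Fin n → ℝ}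
    (hp : ∀ i, 0 ≤ p i) (x : Fin d → ℝ) :
    (RowSample.mk T fun i => 1 / Real.sqrt (p i)).form A x =
      ∑ i ∈ T, (A i ⬝ᵥ x) ^ 2 / p i := by
  refine Finset.sum_congr rfl fun i _ => ?_
  dsimp only
  rw [mul_pow, div_pow, Real.sq_sqrt (hp i)]
  ring

/-- The form of B is at most 9/8 that of S', hence at most twice that of S. The factor 2 in the
weights thus makes wᵢ at least the leverage score in A_S, so Chernoff applies with δ = ε² / (c log
d). -/
theorem weightedSample_approximates_le (A : Matrix (Fin n) (Fin d) ℝ) {c ε : ℝ}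
    (hc : 0 < c * Real.log d) (hε0 : 0 < ε) (hε : ε ≤ 1) {S S' : Finset (Fin n)} (hS : S' ⊆ S)
    {B : RowSample n} (hB : B.Approximates A (1 / 8) S') {w : Fin n → ℝ≥0∞}
    (hw : ∀ i ∈ S, 2 * genLeverage (B.toMatrix A) (A i) ≤ w i) :
    bernoulliProb S (fun i => (sampleProb c ε d (w i)).toReal) (fun T =>
      ¬ (RowSample.mk T fun i => 1 / Real.sqrt (sampleProb c ε d (w i)).toReal).Approximates
        A (ε / 8) S) ≤ 2 * d * Real.exp (-(c * Real.log d / 256)) := by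
  have hθ : 0 < c * Real.log d / ε ^ 2 := by positivity
  obtain ⟨R, v, h1, h2, h3, -, h5⟩ := exists_whitening A S
  set p : Fin n → ℝ := fun i => (sampleProb c ε d (w i)).toReal with hp
  have hp0 : ∀ i, 0 ≤ p i := fun i => ENNReal.toReal_nonneg
  have hp1 : ∀ i, p i ≤ 1 := fun i => toReal_sampleProb_le_one c ε d (w i)
  have key := bernoulliProb_deviation_le S hp0 hp1 v h3 (δ := (c * Real.log d / ε ^ 2)⁻¹)
    (ε := ε / 8) (by positivity) (fun i hi => by
      rcases toReal_sampleProb_eq (w := w i) hθ with h | ⟨hwt, h⟩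
      · exact Or.inl h
      · right
        have hpi : p i * (c * Real.log d / ε ^ 2)⁻¹ = (w i).toReal := by
          rw [hp]; dsimp only; rw [h, mul_comm, inv_mul_cancel_left₀ hθ.ne']
        rw [hpi]
        refine whitened_norm_le (h1 i hi) h2 (h5 i hi) (fun x => ?_) ENNReal.toReal_nonneg
        -- Rows with infinite score have infinite weight and are kept surely, which is the other
        -- branch.
        have hlt : genLeverage (B.toMatrix A) (A i) ≠ ⊤ := by
          intro htop
          have := hw i hi
          rw [htop, ENNReal.mul_top two_ne_zero, top_le_iff] at this
          exact hwt this
        have h6 := dotProduct_sq_le_genLeverage hlt x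
        rw [B.form_eq] at h6
        have h7 : 2 * (genLeverage (B.toMatrix A) (A i)).toReal ≤ (w i).toReal := by
          have := ENNReal.toReal_mono hwt (hw i hi)
          rwa [ENNReal.toReal_mul, ENNReal.toReal_ofNat] at this
        have h8 := (abs_le.mp (hB x)).2
        have h9 := rowForm_mono A hS x
        have h10 := rowForm_nonneg A S' x
        have h11 : B.form A x ≤ 2 * rowForm A S x := by linarith
        calc _ ≤ (genLeverage (B.toMatrix A) (A i)).toReal * (2 * rowForm A S x) :=
              h6.trans (mul_le_mul_of_nonneg_left h11 ENNReal.toReal_nonneg)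
          _ = 2 * (genLeverage (B.toMatrix A) (A i)).toReal * rowForm A S x := by ring
          _ ≤ _ := mul_le_mul_of_nonneg_right h7 (rowForm_nonneg A S x)) (by positivity)
      (by linarith)
  refine (bernoulliProb_mono hp0 hp1 ?_).trans (key.trans_eq (by
    congr 3; field_simp; norm_num; ring))
  intro T hT hfail
  rw [RowSample.Approximates] at hfail
  push Not at hfail
  obtain ⟨x, hx⟩ := hfail
  refine ⟨R *ᵥ x, ?_⟩
  rw [form_of_weights A T hp0] at hx
  rw [h2]
  refine hx.trans_eq ?_
  congr 2
  · exact Finset.sum_congr rfl fun i hi => by rw [h1 i (hT hi)]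
  · exact Finset.sum_congr rfl fun i hi => by rw [h1 i hi]

/-- Exceptional rows cost at most 1 each. On V the form is at most 4 times that of S', hence at most
32/7 < 5 times that of B, so each score is at most 5 |vᵢ|². The upper factor 4 on the weights gives
20, and Σ |vᵢ|² ≤ d. -/
theorem sum_sampleProb_le (A : Matrix (Fin n) (Fin d) ℝ) {c ε : ℝ} {r : ℕ}
    (hc : 0 < c * Real.log d) (hε0 : 0 < ε) {S S' : Finset (Fin n)} (hdom : Dominates A r S S')
    {B : RowSample n} (hB : B.Approximates A (1 / 8) S') {w : Fin n → ℝ≥0∞}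
    (hw : ∀ i ∈ S, w i ≤ 4 * genLeverage (B.toMatrix A) (A i)) :
    ∑ i ∈ S, (sampleProb c ε d (w i)).toReal ≤ r + 20 * (c * Real.log d / ε ^ 2) * d := by
  have hθ : 0 < c * Real.log d / ε ^ 2 := by positivity
  obtain ⟨V, hV, hVr, hVx⟩ := hdom
  obtain ⟨R, v, h1, h2, -, h4, -⟩ := exists_whitening A V
  rw [← Finset.sum_sdiff hV]
  refine add_le_add ?_ ?_
  · calc _ ≤ ∑ _i ∈ S \ V, (1 : ℝ) :=
          Finset.sum_le_sum fun i _ => toReal_sampleProb_le_one c ε d (w i)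
      _ = ((S \ V).card : ℝ) := by simp
      _ ≤ r := by exact_mod_cast hVr
  · calc _ ≤ ∑ i ∈ V, 20 * (c * Real.log d / ε ^ 2) * (v i ⬝ᵥ v i) := by
          refine Finset.sum_le_sum fun i hi => ?_
          have hnn : 0 ≤ v i ⬝ᵥ v i := Finset.sum_nonneg fun j _ => mul_self_nonneg _
          have h6 : genLeverage (B.toMatrix A) (A i) ≤ ENNReal.ofReal (5 * (v i ⬝ᵥ v i)) := by
            refine genLeverage_le (by positivity) fun x => ?_
            rw [B.form_eq, h1 i hi, mul_right_comm]
            refine (dotProduct_sq_le _ _).trans ?_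
            rw [h2, mul_comm]
            refine mul_le_mul_of_nonneg_right ?_ hnn
            have h7 := (abs_le.mp (hB x)).1
            have h8 := hVx x
            linarith [rowForm_nonneg A S' x]
          have h7 : w i ≤ ENNReal.ofReal (20 * (v i ⬝ᵥ v i)) := by
            refine (hw i (hV hi)).trans ((mul_le_mul_right h6 4).trans_eq ?_)
            rw [show (20 : ℝ) * (v i ⬝ᵥ v i) = 4 * (5 * (v i ⬝ᵥ v i)) by ring,
              ENNReal.ofReal_mul (by norm_num)]
            simp
          refine (toReal_sampleProb_le hθ.le (by positivity) h7).trans_eq (by ring)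
      _ ≤ _ := by
          rw [← Finset.mul_sum]
          exact mul_le_mul_of_nonneg_left h4 (by positivity)

theorem toOuterMeasure_weightedSample_le (A : Matrix (Fin n) (Fin d) ℝ) {c ε μ : ℝ} {r : ℕ}
    (hc : 0 < c * Real.log d) (hε0 : 0 < ε) (hε : ε ≤ 1) {S S' : Finset (Fin n)} (hS : S' ⊆ S)
    (hdom : Dominates A r S S') {B : RowSample n} (hB : B.Approximates A (1 / 8) S')
    {w : Fin n → ℝ≥0∞} (hw : ∀ i ∈ S, 2 * genLeverage (B.toMatrix A) (A i) ≤ w i ∧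
      w i ≤ 4 * genLeverage (B.toMatrix A) (A i))
    (hμ : r + 20 * (c * Real.log d / ε ^ 2) * d ≤ μ) :
    (weightedSample c ε d S w).toOuterMeasure
      {X | ¬ ((X.rows.card : ℝ) ≤ 3 * μ ∧ X.Approximates A (ε / 8) S)} ≤
      ENNReal.ofReal (2 * d * Real.exp (-(c * Real.log d / 256)) + Real.exp (-μ)) := by
  rw [weightedSample, PMF.toOuterMeasure_map_apply]
  refine (toOuterMeasure_bernoulliSubset S _ _ _).trans_le (ENNReal.ofReal_le_ofReal ?_)
  have hp0 : ∀ i, 0 ≤ (sampleProb c ε d (w i)).toReal := fun i => ENNReal.toReal_nonneg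
  have hp1 : ∀ i, (sampleProb c ε d (w i)).toReal ≤ 1 :=
    fun i => toReal_sampleProb_le_one c ε d (w i)
  have h1 := weightedSample_approximates_le A hc hε0 hε hS hB fun i hi => (hw i hi).1
  have h2 := bernoulliProb_card_gt_le S hp0 hp1
    ((sum_sampleProb_le A hc hε0 hdom hB fun i hi => (hw i hi).2).trans hμ)
  refine le_trans ?_ (add_le_add h1 h2)
  refine le_trans (bernoulliProb_mono hp0 hp1 ?_) (bernoulliProb_or_le hp0 hp1 _ _)
  rintro T - hT
  by_contra hcon
  rw [not_or, not_not, not_lt] at hcon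
  exact hT ⟨hcon.2, hcon.1⟩

end WeightedRound

/-! ### Union bounds for the whole procedure -/

section UnionBound

theorem toOuterMeasure_le_one {α : Type*} (p : PMF α) (s : Set α) : p.toOuterMeasure s ≤ 1 := by
  have h : p.toOuterMeasure Set.univ = 1 :=
    (p.toOuterMeasure_apply_eq_one_iff Set.univ).mpr (Set.subset_univ _)
  exact h ▸ MeasureTheory.measure_mono (Set.subset_univ s)

theorem one_sub_le_toOuterMeasure {α : Type*} (p : PMF α) {good bad : Set α} {b : ℝ≥0∞}
    (h : ∀ x, x ∉ bad → x ∈ good) (hb : p.toOuterMeasure bad ≤ b) :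
    1 - b ≤ p.toOuterMeasure good := by
  rw [tsub_le_iff_right]
  have h1 : p.toOuterMeasure Set.univ = 1 :=
    (p.toOuterMeasure_apply_eq_one_iff Set.univ).mpr (Set.subset_univ _)
  have h2 : (Set.univ : Set α) ⊆ good ∪ bad := fun x _ => by
    by_cases hx : x ∈ bad
    · exact Or.inr hx
    · exact Or.inl (h x hx)
  calc (1 : ℝ≥0∞) = p.toOuterMeasure Set.univ := h1.symm
    _ ≤ p.toOuterMeasure good + p.toOuterMeasure bad :=
        (MeasureTheory.measure_mono h2).trans (MeasureTheory.measure_union_le _ _)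
    _ ≤ _ := by gcongr

/-- Conditional union bound. The second hypothesis is uniform over good outcomes of the first stage,
so what follows may depend on them arbitrarily. -/
theorem toOuterMeasure_bind_le {α β : Type*} (p : PMF α) (f : α → PMF β) {bad₁ : Set α}
    {bad : Set β} {a b : ℝ≥0∞} (h₁ : p.toOuterMeasure bad₁ ≤ a)
    (h : ∀ x, x ∉ bad₁ → (f x).toOuterMeasure bad ≤ b) :
    (p.bind f).toOuterMeasure bad ≤ a + b := by
  rw [PMF.toOuterMeasure_bind_apply]
  calc ∑' x, p x * (f x).toOuterMeasure bad
      ≤ ∑' x, (bad₁.indicator p x + p x * b) := by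
        refine ENNReal.tsum_le_tsum fun x => ?_
        by_cases hx : x ∈ bad₁
        · rw [Set.indicator_of_mem hx]
          calc _ ≤ p x * 1 := by gcongr; exact toOuterMeasure_le_one _ _
            _ = p x := mul_one _
            _ ≤ _ := le_self_add
        · rw [Set.indicator_of_notMem hx, zero_add]
          gcongr
          exact h x hx
    _ = p.toOuterMeasure bad₁ + b := by
        rw [ENNReal.tsum_add, ENNReal.tsum_mul_right, p.tsum_coe, one_mul,
          PMF.toOuterMeasure_apply]
    _ ≤ a + b := by gcongr

theorem tsum_bind_mul {α β : Type*} (p : PMF α) (f : α → PMF β) (g : β → ℝ≥0∞) :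
    ∑' b, p.bind f b * g b = ∑' a, p a * ∑' b, f a b * g b := by
  simp only [PMF.bind_apply, ← ENNReal.tsum_mul_right, ← ENNReal.tsum_mul_left]
  rw [ENNReal.tsum_comm]
  simp only [mul_assoc]

theorem tsum_pure_mul {α : Type*} (a : α) (g : α → ℝ≥0∞) :
    ∑' b, PMF.pure a b * g b = g a := by
  rw [tsum_eq_single a fun b hb => by rw [PMF.pure_apply_of_ne _ _ hb, zero_mul],
    PMF.pure_apply_self, one_mul]

theorem tsum_map_mul {α β : Type*} (p : PMF α) (f : α → β) (g : β → ℝ≥0∞) :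
    ∑' b, p.map f b * g b = ∑' a, p a * g (f a) := by
  rw [PMF.map, tsum_bind_mul]
  simp only [Function.comp_apply, tsum_pure_mul]

variable {n d : ℕ}

/-! ### The chain of halvings -/

/-- Averaging over one halving replaces 1 + y by 1 + y/2 per row, hence the induction over all y. -/
theorem halvingChain_card_mgf (n L : ℕ) {y : ℝ} (hy : 0 ≤ y) :
    ∑' S, halvingChain n L S * ENNReal.ofReal ((1 + y) ^ (S L).card) ≤
      ENNReal.ofReal (Real.exp (n * (y / 2 ^ L))) := by
  induction L generalizing y with
  | zero =>
    rw [halvingChain, tsum_pure_mul]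
    refine ENNReal.ofReal_le_ofReal ?_
    rw [Finset.card_univ, Fintype.card_fin, pow_zero, div_one, Real.exp_nat_mul]
    have := Real.add_one_le_exp y
    gcongr
    linarith
  | succ L ih =>
    rw [halvingChain, tsum_bind_mul]
    have h1 : ∀ S : Finset (Fin n), bernoulliMean S (fun _ => (2⁻¹ : ℝ≥0∞).toReal)
        (fun T => (1 + y) ^ T.card) = (1 + y / 2) ^ S.card := by
      intro S
      induction S using Finset.induction_on with
      | empty => simp [bernoulliMean_empty]
      | insert i S hi ihS =>
        have h2 : bernoulliMean S (fun _ => (2⁻¹ : ℝ≥0∞).toReal)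
            (fun T => (1 + y) ^ (insert i T).card) = (1 + y) * (1 + y / 2) ^ S.card := by
          rw [← ihS, ← bernoulliMean_const_mul]
          refine Finset.sum_congr rfl fun T hT => ?_
          beta_reduce
          rw [Finset.card_insert_of_notMem fun h => hi (Finset.mem_powerset.mp hT h), pow_succ']
        rw [bernoulliMean_insert hi, h2, ihS, Finset.card_insert_of_notMem hi, pow_succ']
        simp only [ENNReal.toReal_inv, ENNReal.toReal_ofNat]
        ring
    have h3 := ih (y := y / 2) (by positivity)
    refine le_trans (le_of_eq ?_) (h3.trans_eq ?_)
    · refine tsum_congr fun S => ?_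
      rw [tsum_map_mul]
      simp only [Function.update_self]
      rw [tsum_bernoulliSubset_mul _ _ _ fun T => by positivity, h1]
    · rw [pow_succ', div_div]

theorem toOuterMeasure_halvingChain_card_le (n L : ℕ) {m₀ m : ℝ} (h : n ≤ m₀ * 2 ^ L) :
    (halvingChain n L).toOuterMeasure {S | m < (S L).card} ≤
      ENNReal.ofReal (Real.exp (2 * m₀ - m)) := by
  have he : 1 ≤ Real.exp 1 := Real.one_le_exp zero_le_one
  have h1 := halvingChain_card_mgf n L (y := Real.exp 1 - 1) (by linarith)
  rw [PMF.toOuterMeasure_apply]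
  calc ∑' S, Set.indicator {S | m < ((S L).card : ℝ)} (halvingChain n L) S
      ≤ ∑' S, ENNReal.ofReal (Real.exp (-m)) * (halvingChain n L S *
        ENNReal.ofReal ((1 + (Real.exp 1 - 1)) ^ (S L).card)) := by
        refine ENNReal.tsum_le_tsum fun S => ?_
        by_cases hS : m < ((S L).card : ℝ)
        · rw [Set.indicator_of_mem (show S ∈ {S | m < ((S L).card : ℝ)} from hS), mul_left_comm,
            ← ENNReal.ofReal_mul (Real.exp_pos _).le]
          refine le_mul_of_one_le_right' ?_
          rw [ENNReal.one_le_ofReal, add_sub_cancel, ← Real.exp_nat_mul, mul_one, ← Real.exp_add,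
            Real.one_le_exp_iff]
          linarith
        · rw [Set.indicator_of_notMem (show S ∉ {S | m < ((S L).card : ℝ)} from hS)]
          exact zero_le
    _ ≤ _ := by
        rw [ENNReal.tsum_mul_left]
        refine (mul_le_mul_right h1 _).trans ?_
        rw [← ENNReal.ofReal_mul (Real.exp_pos _).le, ← Real.exp_add]
        refine ENNReal.ofReal_le_ofReal (Real.exp_le_exp.mpr ?_)
        have h2 : n * ((Real.exp 1 - 1) / 2 ^ L) ≤ 2 * m₀ := by
          rw [mul_div_assoc', div_le_iff₀ (by positivity)]
          have h3 : Real.exp 1 - 1 ≤ 2 := by linarith [Real.exp_one_lt_d9]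
          have h4 : (0 : ℝ) ≤ n := Nat.cast_nonneg n
          nlinarith [mul_le_mul_of_nonneg_left h3 h4]
        linarith

/-- Every link of the chain is a good halving. -/
def ChainGood (A : Matrix (Fin n) (Fin d) ℝ) (r L : ℕ) (S : ℕ → Finset (Fin n)) : Prop :=
  S 0 = Finset.univ ∧ ∀ ℓ < L, S (ℓ + 1) ⊆ S ℓ ∧ Dominates A r (S ℓ) (S (ℓ + 1))

theorem toOuterMeasure_halvingChain_bad_le (A : Matrix (Fin n) (Fin d) ℝ) {r : ℕ} {η : ℝ}
    (h : ∀ S : Finset (Fin n),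
      bernoulliProb S (fun _ => 1 / 2) (fun T => ¬ Dominates A r S T) ≤ η) (L : ℕ) :
    (halvingChain n L).toOuterMeasure {S | ¬ ChainGood A r L S} ≤ L * ENNReal.ofReal η := by
  induction L with
  | zero =>
    rw [halvingChain, PMF.toOuterMeasure_pure_apply, if_neg]
    · simp
    · simp [ChainGood]
  | succ L ih =>
    rw [halvingChain, Nat.cast_succ, add_mul, one_mul]
    refine toOuterMeasure_bind_le _ _ ih fun S hS => ?_
    rw [Set.mem_ofPred_eq, not_not] at hS
    rw [PMF.toOuterMeasure_map_apply]
    have hp0 : ∀ i : Fin n, (0 : ℝ) ≤ (fun _ => 1 / 2) i := fun _ => by norm_num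
    have hp1 : ∀ i : Fin n, (fun _ => (1 / 2 : ℝ)) i ≤ 1 := fun _ => by norm_num
    refine (toOuterMeasure_bernoulliSubset _ _ _ _).trans_le (ENNReal.ofReal_le_ofReal ?_)
    have hhalf : (fun _ : Fin n => (2⁻¹ : ℝ≥0∞).toReal) = fun _ => 1 / 2 := by
      funext i; simp
    rw [hhalf]
    refine (bernoulliProb_mono hp0 hp1 ?_).trans (h (S L))
    intro T hT hbad hdom
    refine hbad ⟨?_, fun ℓ hℓ => ?_⟩
    · beta_reduce
      rw [Function.update_of_ne (Nat.succ_ne_zero L).symm]; exact hS.1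
    · beta_reduce
      rw [Function.update_of_ne (show ℓ ≠ L + 1 by omega)]
      rcases Nat.lt_succ_iff_lt_or_eq.mp hℓ with h1 | rfl
      · rw [Function.update_of_ne (show ℓ + 1 ≠ L + 1 by omega)]
        exact hS.2 ℓ h1
      · rw [Function.update_self]
        exact ⟨hT, hdom⟩

/-! ### The sampling rounds -/

/-- The samples of the first `k` rounds are accurate and have at most `3 μ ℓ` rows. -/
def RoundsGood (A : Matrix (Fin n) (Fin d) ℝ) (ε : ℝ) (μ : ℕ → ℝ) (S : ℕ → Finset (Fin n))
    (L k : ℕ) (B : ℕ → RowSample n) : Prop :=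
  ∀ ℓ, L - k ≤ ℓ → ℓ ≤ L → ((B ℓ).rows.card : ℝ) ≤ 3 * μ ℓ ∧
    (B ℓ).Approximates A ((if ℓ = 0 then ε else 1 / 2) / 8) (S ℓ)

theorem toOuterMeasure_halvingRounds_bad_le (A : Matrix (Fin n) (Fin d) ℝ) {c ε η : ℝ} {r : ℕ}
    {μ : ℕ → ℝ} (hc : 0 < c * Real.log d) (hε0 : 0 < ε) (hε : ε ≤ 1) {rule : WeightRule n}
    (hrule : rule.IsValid A) {S : ℕ → Finset (Fin n)} {L : ℕ} (hS : ChainGood A r L S)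
    (hSL : ((S L).card : ℝ) ≤ 3 * μ L)
    (hμ : ∀ ℓ, r + 20 * (c * Real.log d / (if ℓ = 0 then ε else 1 / 2) ^ 2) * d ≤ μ ℓ)
    (hη : ∀ ℓ, 2 * d * Real.exp (-(c * Real.log d / 256)) + Real.exp (-μ ℓ) ≤ η)
    (k : ℕ) (hk : k ≤ L) :
    (halvingRounds d c ε rule S L k).toOuterMeasure {B | ¬ RoundsGood A ε μ S L k B} ≤
      k * ENNReal.ofReal η := by
  have hacc : ∀ ℓ : ℕ, 0 < (if ℓ = 0 then ε else 1 / 2) ∧ (if ℓ = 0 then ε else 1 / 2) ≤ 1 := by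
    intro ℓ
    split_ifs
    · exact ⟨hε0, hε⟩
    · norm_num
  induction k with
  | zero =>
    rw [halvingRounds, PMF.toOuterMeasure_pure_apply, if_neg]
    · simp
    · rw [Set.mem_ofPred_eq, not_not]
      intro ℓ h1 h2
      obtain rfl : ℓ = L := by omega
      refine ⟨hSL, fun x => ?_⟩
      have h3 : (RowSample.mk (S ℓ) fun _ => 1).form A x = rowForm A (S ℓ) x := by
        simp [RowSample.form, rowForm]
      rw [h3, sub_self, abs_zero]
      exact mul_nonneg (by have := (hacc ℓ).1; positivity) (rowForm_nonneg A _ x)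
  | succ k ih =>
    rw [halvingRounds, Nat.cast_succ, add_mul, one_mul]
    refine toOuterMeasure_bind_le _ _ (ih (by omega)) fun B hB => ?_
    rw [Set.mem_ofPred_eq, not_not] at hB
    rw [PMF.toOuterMeasure_map_apply]
    obtain ⟨ℓ, hℓ⟩ : ∃ ℓ, L - (k + 1) = ℓ := ⟨_, rfl⟩
    have hℓ1 : L - k = ℓ + 1 := by omega
    rw [hℓ]
    obtain ⟨hsub, hdom⟩ := hS.2 ℓ (by omega)
    -- Level ℓ + 1 has accuracy (1/2)/8, or is exact at the top; 1/8 is all that the next round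
    -- needs.
    have hB1 : (B (ℓ + 1)).Approximates A (1 / 8) (S (ℓ + 1)) := by
      intro x
      refine ((hB (ℓ + 1) hℓ1.le (by omega)).2 x).trans
        (mul_le_mul_of_nonneg_right ?_ (rowForm_nonneg A _ x))
      have := (hacc (ℓ + 1)).2
      linarith
    have key := toOuterMeasure_weightedSample_le A hc (hacc ℓ).1 (hacc ℓ).2 hsub hdom hB1
      (hrule S B ℓ) (hμ ℓ)
    refine (MeasureTheory.measure_mono ?_).trans
      (key.trans (ENNReal.ofReal_le_ofReal (hη ℓ)))
    intro X hX hgood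
    refine hX fun j hj1 hj2 => ?_
    beta_reduce
    rcases eq_or_ne j ℓ with rfl | hj
    · rw [Function.update_self]
      exact hgood
    · rw [Function.update_of_ne hj]
      exact hB j (by omega) hj2

theorem toOuterMeasure_repeatedHalving_bad_le (A : Matrix (Fin n) (Fin d) ℝ) {c ε η₁ η₂ η₃ : ℝ}
    {r : ℕ} {μ : ℕ → ℝ} (hc : 0 < c * Real.log d) (hε0 : 0 < ε) (hε : ε ≤ 1)
    {rule : WeightRule n} (hrule : rule.IsValid A)
    (hchain : ∀ S : Finset (Fin n),
      bernoulliProb S (fun _ => 1 / 2) (fun T => ¬ Dominates A r S T) ≤ η₁)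
    (hsize : (halvingChain n (numLevels n d)).toOuterMeasure
      {S | 3 * μ (numLevels n d) < (S (numLevels n d)).card} ≤ ENNReal.ofReal η₂)
    (hμ : ∀ ℓ, r + 20 * (c * Real.log d / (if ℓ = 0 then ε else 1 / 2) ^ 2) * d ≤ μ ℓ)
    (hη : ∀ ℓ, 2 * d * Real.exp (-(c * Real.log d / 256)) + Real.exp (-μ ℓ) ≤ η₃) :
    (repeatedHalving n d c ε rule).toOuterMeasure
      {B | ¬ ((∀ ℓ ≤ numLevels n d, ((B ℓ).rows.card : ℝ) ≤ 3 * μ ℓ) ∧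
        (B 0).Approximates A (ε / 8) Finset.univ)} ≤
      numLevels n d * ENNReal.ofReal η₁ + ENNReal.ofReal η₂ +
        numLevels n d * ENNReal.ofReal η₃ := by
  set L := numLevels n d
  refine toOuterMeasure_bind_le (bad₁ := {S | ¬ ChainGood A r L S} ∪
    {S | 3 * μ L < (S L).card}) _ _ ((MeasureTheory.measure_union_le _ _).trans
      (add_le_add (toOuterMeasure_halvingChain_bad_le A hchain L) hsize)) fun S hS => ?_
  rw [Set.mem_union, not_or, Set.mem_ofPred_eq, Set.mem_ofPred_eq, not_not, not_lt] at hS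
  refine (MeasureTheory.measure_mono ?_).trans (toOuterMeasure_halvingRounds_bad_le A hc hε0 hε
    hrule hS.1 hS.2 hμ hη L le_rfl)
  intro B hB hgood
  refine hB ⟨fun ℓ hℓ => (hgood ℓ (by omega) hℓ).1, ?_⟩
  have := (hgood 0 (by omega) (by omega)).2
  rwa [hS.1.1, if_pos rfl] at this

end UnionBound

/-! ### Kronecker products of spectral approximations -/

section KroneckerApprox

/-- Changing one factor at a time writes each difference as a sum of Kronecker products of positive
semidefinite matrices. -/
theorem sandwich_kronecker {m m' : Type*} [Finite m] [Finite m']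
    {G₁ H₁ : Matrix m m ℝ} {G₂ H₂ : Matrix m' m' ℝ} {a b : ℝ} (ha : 0 ≤ a) (hb : 0 ≤ b)
    (hG₁ : G₁.PosSemidef) (hG₂ : G₂.PosSemidef) (hH₁ : H₁.PosSemidef) (hH₂ : H₂.PosSemidef)
    (ha₁ : (H₁ - a • G₁).PosSemidef) (ha₂ : (H₂ - a • G₂).PosSemidef)
    (hb₁ : (b • G₁ - H₁).PosSemidef) (hb₂ : (b • G₂ - H₂).PosSemidef) :
    (H₁ ⊗ₖ H₂ - a ^ 2 • (G₁ ⊗ₖ G₂)).PosSemidef ∧ (b ^ 2 • (G₁ ⊗ₖ G₂) - H₁ ⊗ₖ H₂).PosSemidef := by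
  constructor
  · have h : H₁ ⊗ₖ H₂ - a ^ 2 • (G₁ ⊗ₖ G₂) =
        (H₁ - a • G₁) ⊗ₖ H₂ + (a • G₁) ⊗ₖ (H₂ - a • G₂) := by
      ext i j
      simp only [Matrix.sub_apply, Matrix.add_apply, Matrix.smul_apply, Matrix.kroneckerMap_apply,
        smul_eq_mul]
      ring
    rw [h]
    exact (ha₁.kronecker hH₂).add ((hG₁.smul ha).kronecker ha₂)
  · have h : b ^ 2 • (G₁ ⊗ₖ G₂) - H₁ ⊗ₖ H₂ =
        (b • G₁ - H₁) ⊗ₖ (b • G₂) + H₁ ⊗ₖ (b • G₂ - H₂) := by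
      ext i j
      simp only [Matrix.sub_apply, Matrix.add_apply, Matrix.smul_apply, Matrix.kroneckerMap_apply,
        smul_eq_mul]
      ring
    rw [h]
    exact (hb₁.kronecker (hG₂.smul hb)).add (hH₁.kronecker hb₂)

/-- The margin ε/8 is small enough that (1 ± ε/8)² and their reciprocals all lie in [1 − ε, 1 + ε].
-/
theorem spectralApprox_of_sandwich {m : Type*} [Fintype m] {G H : Matrix m m ℝ} {ε : ℝ}
    (hε0 : 0 < ε) (hε : ε ≤ 1) (hG : G.PosSemidef)
    (ha : (H - (1 - ε / 8) ^ 2 • G).PosSemidef) (hb : ((1 + ε / 8) ^ 2 • G - H).PosSemidef) :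
    SpectralApprox ε G H ∧ SpectralApprox ε H G := by
  have h1 : 0 ≤ (1 - ε / 8) ^ 2 - (1 - ε) := by nlinarith
  have h2 : 0 ≤ (1 + ε) - (1 + ε / 8) ^ 2 := by nlinarith
  have h3 : 0 ≤ 1 - (1 - ε) * (1 + ε / 8) ^ 2 := by nlinarith [mul_nonneg hε0.le hε0.le]
  have h4 : 0 ≤ (1 + ε) * (1 - ε / 8) ^ 2 - 1 := by nlinarith [mul_nonneg hε0.le hε0.le]
  refine ⟨⟨?_, ?_⟩, ?_, ?_⟩
  · convert ha.add (hG.smul h1) using 1; module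
  · convert hb.add (hG.smul h2) using 1; module
  · convert (hb.smul (sub_nonneg.mpr hε)).add (hG.smul h3) using 1; module
  · convert (ha.smul (show 0 ≤ 1 + ε by linarith)).add (hG.smul h4) using 1; module

variable {n d : ℕ}

theorem gram_posSemidef {m : Type*} [Fintype m] (B : Matrix m (Fin d) ℝ) :
    (Bᵀ * B).PosSemidef := by
  have h := Matrix.posSemidef_conjTranspose_mul_self B
  rwa [Matrix.conjTranspose_eq_transpose_of_trivial] at h

theorem posSemidef_of_quadratic {M : Matrix (Fin d) (Fin d) ℝ} (hM : Mᵀ = M)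
    (h : ∀ x, 0 ≤ x ⬝ᵥ (M *ᵥ x)) : M.PosSemidef :=
  Matrix.PosSemidef.of_dotProduct_mulVec_nonneg
    (by rw [Matrix.IsHermitian, Matrix.conjTranspose_eq_transpose_of_trivial, hM])
    fun x => by rw [star_trivial]; exact h x

theorem RowSample.Approximates.gram {X : RowSample n} {A : Matrix (Fin n) (Fin d) ℝ} {δ : ℝ}
    (h : X.Approximates A δ Finset.univ) :
    ((X.toMatrix A)ᵀ * X.toMatrix A - (1 - δ) • (Aᵀ * A)).PosSemidef ∧
      ((1 + δ) • (Aᵀ * A) - (X.toMatrix A)ᵀ * X.toMatrix A).PosSemidef := by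
  have hA : ∀ x, x ⬝ᵥ ((Aᵀ * A) *ᵥ x) = rowForm A Finset.univ x := fun x => by
    rw [dotProduct_gram_mulVec]
    exact Finset.sum_congr rfl fun i _ => by rw [sq]; rfl
  have hX : ∀ x, x ⬝ᵥ (((X.toMatrix A)ᵀ * X.toMatrix A) *ᵥ x) = X.form A x := fun x => by
    rw [dotProduct_gram_mulVec, X.form_eq]
  constructor
  · refine posSemidef_of_quadratic (by simp) fun x => ?_
    rw [Matrix.sub_mulVec, Matrix.smul_mulVec, dotProduct_sub, dotProduct_smul, hA, hX,
      smul_eq_mul]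
    linarith [(abs_le.mp (h x)).1]
  · refine posSemidef_of_quadratic (by simp) fun x => ?_
    rw [Matrix.sub_mulVec, Matrix.smul_mulVec, dotProduct_sub, dotProduct_smul, hA, hX,
      smul_eq_mul]
    linarith [(abs_le.mp (h x)).2]

theorem spectralApprox_kronecker {A₁ A₂ : Matrix (Fin n) (Fin d) ℝ} {X₁ X₂ : RowSample n}
    {ε : ℝ} (hε0 : 0 < ε) (hε : ε ≤ 1) (h₁ : X₁.Approximates A₁ (ε / 8) Finset.univ)
    (h₂ : X₂.Approximates A₂ (ε / 8) Finset.univ) :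
    SpectralApprox ε ((A₁ ⊗ₖ A₂)ᵀ * (A₁ ⊗ₖ A₂))
      ((X₁.toMatrix A₁ ⊗ₖ X₂.toMatrix A₂)ᵀ * (X₁.toMatrix A₁ ⊗ₖ X₂.toMatrix A₂)) ∧
    SpectralApprox ε
      ((X₁.toMatrix A₁ ⊗ₖ X₂.toMatrix A₂)ᵀ * (X₁.toMatrix A₁ ⊗ₖ X₂.toMatrix A₂))
      ((A₁ ⊗ₖ A₂)ᵀ * (A₁ ⊗ₖ A₂)) := by
  have hk : ∀ {m m' : Type} [Fintype m] [Fintype m'] (B₁ : Matrix m (Fin d) ℝ)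
      (B₂ : Matrix m' (Fin d) ℝ), (B₁ ⊗ₖ B₂)ᵀ * (B₁ ⊗ₖ B₂) = (B₁ᵀ * B₁) ⊗ₖ (B₂ᵀ * B₂) := by
    intro m m' _ _ B₁ B₂
    rw [Matrix.mul_kronecker_mul, Matrix.kroneckerMap_transpose]
  rw [hk, hk]
  obtain ⟨ha, hb⟩ := sandwich_kronecker (a := 1 - ε / 8) (b := 1 + ε / 8) (by linarith)
    (by linarith) (gram_posSemidef A₁) (gram_posSemidef A₂) (gram_posSemidef (X₁.toMatrix A₁))
    (gram_posSemidef (X₂.toMatrix A₂)) h₁.gram.1 h₂.gram.1 h₁.gram.2 h₂.gram.2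
  exact spectralApprox_of_sandwich hε0 hε ((gram_posSemidef A₁).kronecker (gram_posSemidef A₂))
    ha hb

end KroneckerApprox

/-! ### Choice of the constants -/

section Constants

variable {n d : ℕ}

theorem le_mul_two_pow_numLevels (hd : 0 < d) (hn : 0 < n) :
    (n : ℝ) ≤ d * 2 ^ numLevels n d := by
  have hd' : (0 : ℝ) < d := Nat.cast_pos.mpr hd
  have hn' : (0 : ℝ) < n := Nat.cast_pos.mpr hn
  have h1 : Real.logb 2 ((n : ℝ) / d) ≤ (numLevels n d : ℝ) := Nat.le_ceil _
  rw [Real.logb_le_iff_le_rpow one_lt_two (by positivity), Real.rpow_natCast,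
    div_le_iff₀ hd'] at h1
  linarith

theorem one_le_numLevels (hd : 0 < d) (hn : d < n) : 1 ≤ numLevels n d := by
  have hd' : (0 : ℝ) < d := Nat.cast_pos.mpr hd
  refine Nat.one_le_iff_ne_zero.mpr (Nat.ceil_pos.mpr (Real.logb_pos one_lt_two ?_)).ne'
  rw [one_lt_div hd']
  exact_mod_cast hn

theorem numLevels_le (hd : 0 < d) : numLevels n d ≤ n := by
  have hd' : (1 : ℝ) ≤ d := by exact_mod_cast hd
  refine Nat.ceil_le.mpr ?_
  rcases Nat.eq_zero_or_pos n with rfl | hn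
  · simp
  have hn' : (0 : ℝ) < n := Nat.cast_pos.mpr hn
  rw [Real.logb_le_iff_le_rpow one_lt_two (by positivity), Real.rpow_natCast]
  calc (n : ℝ) / d ≤ n := div_le_self hn'.le hd'
    _ ≤ 2 ^ n := by exact_mod_cast Nat.lt_two_pow_self.le

/-- The event that a single run succeeds. -/
def RunSucceeds (A : Matrix (Fin n) (Fin d) ℝ) (C ε : ℝ) (B : ℕ → RowSample n) : Prop :=
  (∀ ℓ : ℕ, 1 ≤ ℓ → ℓ ≤ numLevels n d → ((B ℓ).rows.card : ℝ) ≤ C * (d * Real.log d)) ∧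
    ((B 0).rows.card : ℝ) ≤ C * (d * Real.log d / ε ^ 2) ∧
    (B 0).Approximates A (ε / 8) Finset.univ

/-- A single run fails with probability at most `L d^{-κ} / 2`. -/
theorem repeatedHalving_fails_le {κ c : ℝ} (hκ : 0 < κ) (hc : 256 * (κ + 7) ≤ c)
    (hd : 2 ≤ d) (hn : d < n) (A : Matrix (Fin n) (Fin d) ℝ) {ε : ℝ} (hε0 : 0 < ε) (hε : ε ≤ 1)
    {rule : WeightRule n} (hrule : rule.IsValid A) :
    (repeatedHalving n d c ε rule).toOuterMeasure
      {B | ¬ RunSucceeds A (336 * c) ε B} ≤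
      ENNReal.ofReal (numLevels n d * (d : ℝ) ^ (-κ) / 2) := by
  have hd2 : (2 : ℝ) ≤ d := by exact_mod_cast hd
  have hlog2 : Real.log 2 ≤ Real.log d := Real.log_le_log two_pos hd2
  have hlog : 1 / 2 < Real.log d := by linarith [Real.log_two_gt_d9]
  set u := Real.log d with hu
  have hc0 : 0 < c := by linarith
  have hcu : 0 < c * u := by positivity
  have hcu1 : 256 ≤ c * u := by nlinarith
  have hcud : c * u * 2 ≤ c * u * d := mul_le_mul_of_nonneg_left hd2 hcu.le
  set L := numLevels n d with hL
  have hL1 : (1 : ℝ) ≤ L := by exact_mod_cast one_le_numLevels (by omega) hn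
  -- q = d^(−κ−7). One power of d pays for the dimension factor in Chernoff; the remaining d^(−6) ≤
  -- 1/64 absorbs the constants.
  set q := Real.exp (-((κ + 7) * u)) with hq
  have hq0 : 0 < q := Real.exp_pos _
  have hqle : ∀ t, c * u / 256 ≤ t → Real.exp (-t) ≤ q := by
    intro t ht
    refine Real.exp_le_exp.mpr (neg_le_neg ?_)
    have : 256 * (κ + 7) * u ≤ c * u := mul_le_mul_of_nonneg_right hc (by linarith)
    linarith
  -- A row counts as heavy above α = 1/(c log d), so at most k₀ heavy rows are kept and r = 4 k₀ ≤ 8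
  -- c d log d.
  set k₀ := ⌈c * u * d⌉₊ with hk₀
  have hk₀l : c * u * d ≤ k₀ := Nat.le_ceil _
  have hk₀u : (k₀ : ℝ) ≤ 2 * (c * u * d) := by
    have := (Nat.ceil_lt_add_one (show 0 ≤ c * u * d by positivity)).le
    linarith
  set acc : ℕ → ℝ := fun ℓ => if ℓ = 0 then ε else 1 / 2 with hacc
  have hacc01 : ∀ ℓ, 0 < acc ℓ ∧ acc ℓ ≤ 1 := by
    intro ℓ
    simp only [hacc]
    split_ifs
    · exact ⟨hε0, hε⟩
    · norm_num
  set μ : ℕ → ℝ := fun ℓ => (4 * k₀ : ℕ) + 20 * (c * u / acc ℓ ^ 2) * d with hμ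
  have haccdiv : ∀ ℓ, c * u ≤ c * u / acc ℓ ^ 2 := by
    intro ℓ
    have := hacc01 ℓ
    exact le_div_self hcu.le (by nlinarith) (pow_le_one₀ this.1.le this.2)
  have hμlow : ∀ ℓ, 20 * (c * u * d) ≤ μ ℓ := by
    intro ℓ
    have h1 : c * u * d ≤ c * u / acc ℓ ^ 2 * d :=
      mul_le_mul_of_nonneg_right (haccdiv ℓ) (by linarith)
    have h2 : (0 : ℝ) ≤ ((4 * k₀ : ℕ) : ℝ) := Nat.cast_nonneg _
    simp only [hμ]
    linarith
  -- 84 = 3 · (8 + 20). Accuracy 1/2 multiplies this by 4 at intermediate levels, giving 336.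
  have hμup : ∀ ℓ, 3 * μ ℓ ≤ 84 * c * (d * u / acc ℓ ^ 2) := by
    intro ℓ
    have h1 : c * u * d ≤ c * u / acc ℓ ^ 2 * d :=
      mul_le_mul_of_nonneg_right (haccdiv ℓ) (by linarith)
    have h2 : c * (d * u / acc ℓ ^ 2) = c * u / acc ℓ ^ 2 * d := by ring
    simp only [hμ]
    push_cast
    linarith
  have hmain := toOuterMeasure_repeatedHalving_bad_le A (η₁ := 3 * (d * q)) (η₂ := d * q)
    (η₃ := 3 * (d * q)) (μ := μ) hcu hε0 hε hrule (fun S => by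
      have hα : (0 : ℝ) < (c * u)⁻¹ := by positivity
      refine (bernoulliProb_not_dominates_le A S hα (k₀ := k₀) (by
        rw [inv_mul_eq_div, le_div_iff₀ hcu]; linarith)).trans ?_
      have h1 : Real.exp (-(1 / (32 * (c * u)⁻¹))) ≤ q := hqle _ (by
        rw [one_div, mul_inv, inv_inv]; linarith)
      have h2 : Real.exp (-((k₀ : ℝ) / 2)) ≤ q := hqle _ (by linarith)
      have h3 := mul_le_mul_of_nonneg_left h1 (show (0 : ℝ) ≤ 2 * d by linarith)
      nlinarith) (by
      refine (toOuterMeasure_halvingChain_card_le n L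
        (le_mul_two_pow_numLevels (by omega) (by omega))).trans
          (ENNReal.ofReal_le_ofReal ?_)
      have h1 : Real.exp (2 * d - 3 * μ L) ≤ q := by
        rw [← neg_sub]
        refine hqle _ ?_
        have := hμlow L
        have h2 : 2 * (d : ℝ) ≤ c * u * d := by nlinarith
        linarith
      nlinarith) (fun ℓ => le_rfl) (fun ℓ => by
      have h1 := hqle (c * u / 256) le_rfl
      have h2 : Real.exp (-μ ℓ) ≤ q := hqle _ (by linarith [hμlow ℓ])
      have h3 := mul_le_mul_of_nonneg_left h1 (show (0 : ℝ) ≤ 2 * d by linarith)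
      nlinarith)
  refine ((MeasureTheory.measure_mono ?_).trans hmain).trans ?_
  · intro B hB hgood
    refine hB ⟨fun ℓ h1 h2 => ?_, ?_, hgood.2⟩
    · refine (hgood.1 ℓ h2).trans ((hμup ℓ).trans_eq ?_)
      simp only [hacc, if_neg (show ℓ ≠ 0 by omega)]
      ring
    · refine (hgood.1 0 (Nat.zero_le _)).trans ((hμup 0).trans ?_)
      simp only [hacc, if_pos]
      have : 0 ≤ c * (d * u / ε ^ 2) := by positivity
      linarith
  · have hLo : ((L : ℕ) : ℝ≥0∞) = ENNReal.ofReal L := by simp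
    rw [hLo, ← ENNReal.ofReal_mul (by linarith), ← ENNReal.ofReal_add (by positivity)
      (by positivity), ← ENNReal.ofReal_add (by positivity) (by positivity)]
    refine ENNReal.ofReal_le_ofReal ?_
    have h1 : (d : ℝ) * q = (d : ℝ) ^ (-κ) * ((d : ℝ) ^ 6)⁻¹ := by
      have hd0 : (0 : ℝ) < d := by linarith
      have h2 : q = (d : ℝ) ^ (-κ) * ((d : ℝ) ^ 7)⁻¹ := by
        rw [hq, Real.rpow_def_of_pos hd0, ← Real.exp_log (show (0 : ℝ) < (d : ℝ) ^ 7 by positivity),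
          ← Real.exp_neg, ← Real.exp_add, Real.log_pow, ← hu]
        congr 1; push_cast; ring
      rw [h2]; field_simp
    have h2 : ((d : ℝ) ^ 6)⁻¹ ≤ 1 / 64 := by
      rw [one_div]
      refine inv_anti₀ (by norm_num) ?_
      calc (64 : ℝ) = 2 ^ 6 := by norm_num
        _ ≤ _ := by gcongr
    have h3 : (0 : ℝ) ≤ (d : ℝ) ^ (-κ) := by positivity
    have h4 : (d : ℝ) * q ≤ (d : ℝ) ^ (-κ) * (1 / 64) := by
      rw [h1]; exact mul_le_mul_of_nonneg_left h2 h3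
    have h5 : (L : ℝ) * (d * q) ≤ L * ((d : ℝ) ^ (-κ) * (1 / 64)) :=
      mul_le_mul_of_nonneg_left h4 (by linarith)
    -- L ≥ 1 absorbs the term for the size of the last set; in total 7 L d q ≤ (7/64) L d^(−κ), less
    -- than half.
    have h6 : 1 * (d * q) ≤ L * (d * q) := mul_le_mul_of_nonneg_right hL1 (by positivity)
    have h7 : 0 ≤ L * (d : ℝ) ^ (-κ) := by positivity
    linarith

theorem repeatedHalving₂_succeeds {κ c : ℝ} (hκ : 0 < κ) (hc : 256 * (κ + 7) ≤ c)
    (hd : 2 ≤ d) (hn : d < n) (A₁ A₂ : Matrix (Fin n) (Fin d) ℝ) {ε : ℝ} (hε0 : 0 < ε)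
    (hε : ε ≤ 1) {rule₁ rule₂ : WeightRule n} (h₁ : rule₁.IsValid A₁) (h₂ : rule₂.IsValid A₂) :
    1 - ENNReal.ofReal (numLevels n d * (d : ℝ) ^ (-κ)) ≤
      (repeatedHalving₂ n d c ε rule₁ rule₂).toOuterMeasure
        {B | Succeeds A₁ A₂ (336 * c + (336 * c) ^ 2) ε B.1 B.2} := by
  have hc0 : 0 < c := by linarith
  have hlog : 0 ≤ Real.log d := Real.log_natCast_nonneg d
  have hC : 336 * c ≤ 336 * c + (336 * c) ^ 2 := by
    have := sq_nonneg (336 * c)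
    linarith
  have hbad₁ := repeatedHalving_fails_le hκ hc hd hn A₁ hε0 hε h₁
  have hbad₂ := repeatedHalving_fails_le hκ hc hd hn A₂ hε0 hε h₂
  set L := numLevels n d
  have hsum : (repeatedHalving₂ n d c ε rule₁ rule₂).toOuterMeasure
      {B | ¬ RunSucceeds A₁ (336 * c) ε B.1 ∨ ¬ RunSucceeds A₂ (336 * c) ε B.2} ≤ ENNReal.ofReal (L * (d : ℝ) ^ (-κ)) := by
    have h := toOuterMeasure_bind_le (repeatedHalving n d c ε rule₁)
      (fun B₁ => (repeatedHalving n d c ε rule₂).map fun B₂ => (B₁, B₂))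
      (bad := {B | ¬ RunSucceeds A₁ (336 * c) ε B.1 ∨ ¬ RunSucceeds A₂ (336 * c) ε B.2}) hbad₁ (fun B₁ hB₁ => by
        rw [PMF.toOuterMeasure_map_apply]
        refine (MeasureTheory.measure_mono ?_).trans hbad₂
        rintro B₂ (hB | hB)
        · exact absurd hB hB₁
        · exact hB)
    refine h.trans_eq ?_
    rw [← ENNReal.ofReal_add (by positivity) (by positivity), add_halves]
  refine one_sub_le_toOuterMeasure _ ?_ hsum
  rintro ⟨B₁, B₂⟩ hB
  rw [Set.mem_ofPred_eq, not_or, not_not, not_not] at hB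
  obtain ⟨⟨hi₁, ho₁, ha₁⟩, hi₂, ho₂, ha₂⟩ := hB
  obtain ⟨hk, hk'⟩ := spectralApprox_kronecker hε0 hε ha₁ ha₂
  have hx : 0 ≤ d * Real.log d / ε ^ 2 := by positivity
  refine ⟨fun ℓ hℓ1 hℓ2 => ⟨?_, ?_⟩, hk, hk', ⟨?_, ?_⟩, ?_⟩
  · exact (hi₁ ℓ hℓ1 hℓ2).trans (mul_le_mul_of_nonneg_right hC (by positivity))
  · exact (hi₂ ℓ hℓ1 hℓ2).trans (mul_le_mul_of_nonneg_right hC (by positivity))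
  · exact ho₁.trans (mul_le_mul_of_nonneg_right hC hx)
  · exact ho₂.trans (mul_le_mul_of_nonneg_right hC hx)
  · rw [Fintype.card_prod, Fintype.card_coe, Fintype.card_coe, Nat.cast_mul]
    calc _ ≤ 336 * c * (d * Real.log d / ε ^ 2) * (336 * c * (d * Real.log d / ε ^ 2)) :=
          mul_le_mul ho₁ ho₂ (Nat.cast_nonneg _) (by positivity)
      _ = (336 * c) ^ 2 * ((d : ℝ) ^ 2 * Real.log d ^ 2 / ε ^ 4) := by
          field_simp
      _ ≤ _ := by
          refine mul_le_mul_of_nonneg_right ?_ (by positivity)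
          linarith

theorem numLevels_mul_rpow_le {κ : ℝ} (hκ : 0 < κ) {K : ℕ} (hd : 2 ≤ d) (hn : 0 < n)
    (h : n ≤ d ^ K) :
    numLevels n d * (d : ℝ) ^ (-(K + K * κ + 1)) ≤ (n : ℝ) ^ (-κ) := by
  have hd1 : (1 : ℝ) ≤ d := by exact_mod_cast (by omega : 1 ≤ d)
  have hd0 : (0 : ℝ) < d := by linarith
  have hL : (numLevels n d : ℝ) ≤ (d : ℝ) ^ (K : ℝ) := by
    rw [Real.rpow_natCast]
    exact_mod_cast (numLevels_le (by omega)).trans h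
  have hn' : (n : ℝ) ≤ (d : ℝ) ^ (K : ℝ) := by
    rw [Real.rpow_natCast]
    exact_mod_cast h
  calc numLevels n d * (d : ℝ) ^ (-(K + K * κ + 1))
      ≤ (d : ℝ) ^ (K : ℝ) * (d : ℝ) ^ (-(K + K * κ + 1)) := by gcongr
    _ = (d : ℝ) ^ (-(K * κ + 1)) := by rw [← Real.rpow_add hd0]; congr 1; ring
    _ ≤ (d : ℝ) ^ (K * -κ) := Real.rpow_le_rpow_of_exponent_le hd1 (by linarith)
    _ = ((d : ℝ) ^ (K : ℝ)) ^ (-κ) := Real.rpow_mul hd0.le _ _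
    _ ≤ (n : ℝ) ^ (-κ) :=
        Real.rpow_le_rpow_of_nonpos (Nat.cast_pos.mpr hn) hn' (by linarith)

end Constants

end Halving

end

theorem mainTheorem3 :
    (∀ κ : ℝ, 0 < κ → ∃ c₀ : ℝ, 0 < c₀ ∧ ∀ c : ℝ, c₀ ≤ c → ∃ C : ℝ, 0 < C ∧
      ∀ (n d : ℕ), 2 ≤ d → d < n →
      ∀ (A₁ A₂ : Matrix (Fin n) (Fin d) ℝ) (ε : ℝ), 0 < ε → ε ≤ 1 →
      ∀ (rule₁ rule₂ : Halving.WeightRule n), rule₁.IsValid A₁ → rule₂.IsValid A₂ →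
        1 - ENNReal.ofReal (Halving.numLevels n d * (d : ℝ) ^ (-κ)) ≤
          (Halving.repeatedHalving₂ n d c ε rule₁ rule₂).toOuterMeasure
            {B | Halving.Succeeds A₁ A₂ C ε B.1 B.2}) ∧
    (∀ (κ : ℝ) (K : ℕ), 0 < κ → ∃ c₀ : ℝ, 0 < c₀ ∧ ∀ c : ℝ, c₀ ≤ c → ∃ C : ℝ, 0 < C ∧
      ∀ (n d : ℕ), 2 ≤ d → d < n → n ≤ d ^ K →
      ∀ (A₁ A₂ : Matrix (Fin n) (Fin d) ℝ) (ε : ℝ), 0 < ε → ε ≤ 1 →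
      ∀ (rule₁ rule₂ : Halving.WeightRule n), rule₁.IsValid A₁ → rule₂.IsValid A₂ →
        1 - ENNReal.ofReal ((n : ℝ) ^ (-κ)) ≤
          (Halving.repeatedHalving₂ n d c ε rule₁ rule₂).toOuterMeasure
            {B | Halving.Succeeds A₁ A₂ C ε B.1 B.2}) := by
  refine ⟨fun κ hκ => ?_, fun κ K hκ => ?_⟩
  · refine ⟨256 * (κ + 7), by linarith, fun c hc => ⟨336 * c + (336 * c) ^ 2, ?_, ?_⟩⟩
    · have : 0 < c := by linarith
      positivity
    · intro n d hd hn A₁ A₂ ε hε0 hε rule₁ rule₂ h₁ h₂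
      exact Halving.repeatedHalving₂_succeeds hκ hc hd hn A₁ A₂ hε0 hε h₁ h₂
  -- In this exponent K cancels L ≤ n ≤ d^K and Kκ yields n^(−κ); the 1 only keeps it positive when
  -- K = 0.
  · have hκ' : 0 < K + K * κ + 1 := by positivity
    refine ⟨256 * (K + K * κ + 1 + 7), by linarith,
      fun c hc => ⟨336 * c + (336 * c) ^ 2, ?_, ?_⟩⟩
    · have : 0 < c := by linarith
      positivity
    · intro n d hd hn hnK A₁ A₂ ε hε0 hε rule₁ rule₂ h₁ h₂
      refine le_trans (tsub_le_tsub_left (ENNReal.ofReal_le_ofReal ?_) 1)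
        (Halving.repeatedHalving₂_succeeds hκ' hc hd hn A₁ A₂ hε0 hε h₁ h₂)
      exact Halving.numLevels_mul_rpow_le hκ hd (by omega) hnK
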